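/- **Conventions.** All rings are finite commutative with identity. A finite local ring $S$ is a *Galois ring* if $\mathrm{rad}(S)=pS$ for a prime $p$. For a ring $R$ let $\mathcal P(R)$ be the set of primes dividing $|R|$; for $p\in\mathcal P(R)$ let $R_p$ be the Sylow $p$-subgroup of $R^+$ (a ring with its own identity), and for a set $Q$ of primes let $R_Q=\prod_{p\in Q\cap\mathcal P(R)}R_p$, so that $R=R_Q\times R_{Q'}$ with $Q'=\mathcal P(R)\setminus Q$. The ring $R$ is a *CG-ring* if every $R_p$, $p\in\mathcal P(R)$, is a Galois ring. The group $R_Q^\times$ acts on $R$ by multiplication, as the subgroup $R_Q^\times\times\{1\}$ of $R^\times=R_Q^\times\times R_{Q'}^\times$. An *S-ring* over a finite abelian group $G$ is a subring $\mathcal A$ of $\mathbb Z G$ that has a $\mathbb Z$-basis $\{\sum_{x\in X}x : X\in\mathcal S(\mathcal A)\}$, where $\mathcal S(\mathcal A)$ is a partition of $G$ into non-empty sets (the *basic sets*), one of which consists of the identity alone, and which is closed under $X\mapsto X^{-1}$. An *S-ring over a ring* $R$ is an S-ring $\mathcal A$ over $R^+$ such that $uX\in\mathcal S(\mathcal A)$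 for all $u\in R^\times$ and $X\in\mathcal S(\mathcal A)$. An *$\mathcal A$-ideal* is an ideal of $R$ that is a union of basic sets; a *maximal $\mathcal A$-ideal* is a maximal element of the set of $\mathcal A$-ideals other than $R$. For an $\mathcal A$-ideal $K$, $\mathcal A_K$ denotes the S-ring over $K^+$ whose basic sets are the basic sets of $\mathcal A$ contained in $K$. For $X\subseteq R$ let $I_{\rm L}(X)$ be the largest ideal $K$ of $R$ with $X+K=X$. The S-ring $\mathcal A$ *satisfies the $I/J$-condition* if $I$ and $J$ are $\mathcal A$-ideals and $J\subseteq I_{\rm L}(X)\cap I$ for every basic set $X\subseteq R\setminus I$. The *tensor product* $\mathcal A_1\otimes\mathcal A_2$ of S-rings over $G_1,G_2$ is the S-ring over $G_1\times G_2$ given by the subring $\mathcal A_1\otimes\mathcal A_2$ of $\mathbb Z G_1\otimes\mathbb Z G_2=\mathbb Z[G_1\times G_2]$; its basic sets are the sets $X_1\times X_2$ with $X_i\in\mathcal S(\mathcal A_i)$. **Theorem.** Let $\mathcal A$ be an S-ring over a CG-ring $R$, let $I$ be a maximal $\mathcal A$-ideal, and let $Q=\mathcal P(R/I)$. Suppose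 that every basic set $X\subseteq R\setminus I$ is $Q$-rational, that is, $R_Q^\times X=X$. Let $I^\star$ be the intersection of all $\mathcal A$-ideals containing $R_Q$ (it is the smallest such $\mathcal A$-ideal), and let $J=I\cap I^\star$. Then $\mathcal A$ satisfies the $I/J$-condition. Moreover, if $J=0$, then addition $(x,y)\mapsto x+y$ is a group isomorphism $I^+\times (I^\star)^+\to R^+$ and, under this identification, $\mathcal A=\mathcal A_I\otimes\mathcal A_{I^\star}$. -/

import Mathlib

open scoped AddMonoidAlgebra Pointwise

noncomputable section

/-! ### Schur rings over a finite (additively written) abelian group -/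

/-- `xi X = ∑ x ∈ X, x`, an element of the group ring `ℤ[G]`. -/
def xi {G : Type*} (X : Set G) : AddMonoidAlgebra ℤ G :=
  ∑ᶠ x ∈ X, AddMonoidAlgebra.single x (1 : ℤ)

open Classical in
theorem coeff_xi {G : Type*} [Finite G] (X : Set G) (g : G) :
    (xi X).coeff g = if g ∈ X then 1 else 0 := by
  unfold xi
  rw [finsum_mem_eq_finite_toFinset_sum _ (Set.toFinite X), AddMonoidAlgebra.coeff_sum,
    Finsupp.finsetSum_apply]
  simp [Finsupp.single_apply]

/-- A Schur ring (S-ring) over a finite abelian group `G`: a subring of the group ring `ℤ[G]` which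
is the `ℤ`-span of the elements `xi X`, where `X` runs over a partition `basicSets` of `G` into
non-empty sets such that `{0}` is a class and the classes are permuted by negation. As the classes
are non-empty and pairwise disjoint, the elements `xi X` are automatically linearly independent. -/
structure SchurRing (G : Type*) [AddCommGroup G] [Finite G] extends
    Subring (AddMonoidAlgebra ℤ G) where
  /-- the family `S(A)` of basic sets -/
  basicSets : Set (Set G)
  isPartition : Setoid.IsPartition basicSets
  zero_basic : {0} ∈ basicSets
  neg_basic : ∀ X ∈ basicSets, -X ∈ basicSets
  span_basic : toSubring.toAddSubgroup = AddSubgroup.closure (xi '' basicSets)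

/-- The span of the `xi X`, `X ∈ S`, consists of the functions constant on the classes. -/
theorem mem_closure_xi_iff {G : Type*} [Finite G] {S : Set (Set G)} (hS : Setoid.IsPartition S)
    (f : AddMonoidAlgebra ℤ G) :
    f ∈ AddSubgroup.closure (xi '' S) ↔
      ∀ X ∈ S, ∀ x ∈ X, ∀ y ∈ X, f.coeff x = f.coeff y := by
  classical
  constructor
  · intro hf
    induction hf using AddSubgroup.closure_induction with
    | mem z hz =>
      obtain ⟨Y, hY, rfl⟩ := hz
      intro X hX x hx y hy
      have : ∀ z ∈ X, (z ∈ Y ↔ X = Y) := by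
        intro z hz
        refine ⟨fun h => ?_, fun h => h ▸ hz⟩
        exact (hS.2 z).unique ⟨hX, hz⟩ ⟨hY, h⟩
      rw [coeff_xi, coeff_xi]
      simp [this x hx, this y hy]
    | zero => intros; simp
    | add a b _ _ ha hb =>
      intro X hX x hx y hy
      simp [ha X hX x hx y hy, hb X hX x hx y hy]
    | neg a _ ha =>
      intro X hX x hx y hy
      simp [ha X hX x hx y hy]
  · intro hf
    have hfin : S.Finite := Set.toFinite S
    have hval : ∀ X : Set G, ∃ n : ℤ, X ∈ S → ∀ x ∈ X, f.coeff x = n := by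
      intro X
      by_cases hX : X ∈ S
      · obtain ⟨x, hx⟩ := Setoid.nonempty_of_mem_partition hS hX
        exact ⟨f.coeff x, fun _ y hy => hf X hX y hy x hx⟩
      · exact ⟨0, fun h => absurd h hX⟩
    choose n hn using hval
    have key : f = ∑ X ∈ hfin.toFinset, n X • xi X := by
      ext g
      obtain ⟨Y, ⟨hY, hg⟩, huniq⟩ := hS.2 g
      rw [AddMonoidAlgebra.coeff_sum, Finsupp.finsetSum_apply, Finset.sum_eq_single Y]
      · simp [coeff_xi, hg, hn Y hY g hg]
      · intro X hX hne
        have hgX : g ∉ X := fun h => hne (huniq X ⟨by simpa using hX, h⟩)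
        simp [coeff_xi, hgX]
      · intro h
        exact absurd (by simpa using hY) h
    rw [key]
    refine AddSubgroup.sum_mem _ fun X hX => AddSubgroup.zsmul_mem _ ?_ _
    exact AddSubgroup.subset_closure ⟨X, by simpa using hX, rfl⟩

namespace SchurRing

variable {G : Type*} [AddCommGroup G] [Finite G]

theorem mem_iff (A : SchurRing G) (f : AddMonoidAlgebra ℤ G) :
    f ∈ A.toSubring ↔ ∀ X ∈ A.basicSets, ∀ x ∈ X, ∀ y ∈ X, f.coeff x = f.coeff y := by
  rw [← mem_closure_xi_iff A.isPartition, ← A.span_basic]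
  rfl

theorem xi_mem (A : SchurRing G) {X : Set G} (hX : X ∈ A.basicSets) : xi X ∈ A.toSubring := by
  have : xi X ∈ A.toSubring.toAddSubgroup := by
    rw [A.span_basic]
    exact AddSubgroup.subset_closure ⟨X, hX, rfl⟩
  exact this

theorem basicSets_subset_of_le {A B : SchurRing G} (h : A.toSubring = B.toSubring) :
    A.basicSets ⊆ B.basicSets := by
  classical
  have aux : ∀ {C D : SchurRing G}, C.toSubring = D.toSubring → ∀ X ∈ C.basicSets,
      ∀ Y ∈ D.basicSets, ∀ z, z ∈ X → z ∈ Y → Y ⊆ X := by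
    intro C D hCD X hX Y hY z hzX hzY y hy
    have := (D.mem_iff (xi X)).1 (hCD ▸ C.xi_mem hX) Y hY z hzY y hy
    by_contra hyX
    simp [coeff_xi, hzX, hyX] at this
  intro X hX
  obtain ⟨x, hx⟩ := Setoid.nonempty_of_mem_partition A.isPartition hX
  obtain ⟨Y, ⟨hY, hxY⟩, -⟩ := B.isPartition.2 x
  have : X = Y := Set.Subset.antisymm (aux h.symm Y hY X hX x hxY hx) (aux h X hX Y hY x hx hxY)
  exact this ▸ hY

/-- The basic sets are determined by the subring. -/
theorem ext_toSubring {A B : SchurRing G} (h : A.toSubring = B.toSubring) : A = B := by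
  have hb : A.basicSets = B.basicSets :=
    Set.Subset.antisymm (basicSets_subset_of_le h) (basicSets_subset_of_le h.symm)
  cases A
  cases B
  simp only at h hb
  subst h hb
  rfl

/-- `A`-sets: unions of basic sets. -/
def IsASet (A : SchurRing G) (X : Set G) : Prop := ∃ F ⊆ A.basicSets, X = ⋃₀ F

/-- `A`-subgroups: subgroups of `G` that are `A`-sets. -/
def IsASubgroup (A : SchurRing G) (H : AddSubgroup G) : Prop := A.IsASet (H : Set G)

theorem isASet_iff (A : SchurRing G) (X : Set G) :
    A.IsASet X ↔ ∀ Y ∈ A.basicSets, ∀ y ∈ Y, y ∈ X → Y ⊆ X := by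
  constructor
  · rintro ⟨F, hF, rfl⟩ Y hY y hy ⟨Z, hZ, hyZ⟩
    have : Y = Z := (A.isPartition.2 y).unique ⟨hY, hy⟩ ⟨hF hZ, hyZ⟩
    exact this ▸ Set.subset_sUnion_of_mem hZ
  · intro h
    refine ⟨{Y | Y ∈ A.basicSets ∧ Y ⊆ X}, fun Y hY => hY.1, ?_⟩
    ext x
    constructor
    · intro hx
      obtain ⟨Y, ⟨hY, hxY⟩, -⟩ := A.isPartition.2 x
      exact ⟨Y, ⟨hY, h Y hY x hxY hx⟩, hxY⟩
    · rintro ⟨Y, hY, hxY⟩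
      exact hY.2 hxY

/-- The S-ring `A_H` over an `A`-subgroup `H`: its basic sets are the basic sets of `A` contained in
`H`, and its elements are the elements of `ℤ[H]` lying in `A`. -/
def restrict (A : SchurRing G) (H : AddSubgroup G) (hH : A.IsASubgroup H) : SchurRing H :=
  have hpart : Setoid.IsPartition {Y : Set H | (Subtype.val '' Y : Set G) ∈ A.basicSets} := by
    refine ⟨fun h => A.isPartition.1 (by simpa using h), fun h => ?_⟩
    obtain ⟨X, ⟨hX, hhX⟩, huniq⟩ := A.isPartition.2 (h : G)
    have hXH : X ⊆ (H : Set G) := (A.isASet_iff _).1 hH X hX h hhX h.2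
    have him : (Subtype.val '' (Subtype.val ⁻¹' X : Set H) : Set G) = X := by
      exact Set.image_preimage_eq_of_subset fun x hx => ⟨⟨x, hXH hx⟩, rfl⟩
    refine ⟨Subtype.val ⁻¹' X, ⟨?_, hhX⟩, ?_⟩
    · change (Subtype.val '' (Subtype.val ⁻¹' X : Set H) : Set G) ∈ A.basicSets
      rw [him]
      exact hX
    · rintro Y ⟨hY, hhY⟩
      rw [← huniq _ ⟨hY, ⟨h, hhY, rfl⟩⟩]
      exact (Set.preimage_image_eq Y Subtype.val_injective).symm
  { toSubring := A.toSubring.comap (AddMonoidAlgebra.mapDomainRingHom ℤ H.subtype)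
    basicSets := {Y | (Subtype.val '' Y : Set G) ∈ A.basicSets}
    isPartition := hpart
    zero_basic := by simpa using A.zero_basic
    neg_basic := by
      intro Y hY
      have h : (Subtype.val '' (-Y) : Set G) = -(Subtype.val '' Y) :=
        Set.image_neg_of_apply_neg_eq_neg (fun _ _ => rfl)
      change (Subtype.val '' (-Y) : Set G) ∈ A.basicSets
      rw [h]
      exact A.neg_basic _ hY
    span_basic := by
      ext f
      rw [mem_closure_xi_iff hpart]
      change AddMonoidAlgebra.mapDomainRingHom ℤ H.subtype f ∈ A.toSubring ↔ _
      rw [A.mem_iff]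
      have hin : ∀ h : H, (AddMonoidAlgebra.mapDomainRingHom ℤ H.subtype f).coeff (h : G) =
          f.coeff h := fun h => Finsupp.mapDomain_apply Subtype.val_injective _ h
      have hout : ∀ g : G, g ∉ H →
          (AddMonoidAlgebra.mapDomainRingHom ℤ H.subtype f).coeff g = 0 := fun g hg =>
        Finsupp.mapDomain_of_notMem_range _ _ (by simpa using hg)
      constructor
      · intro h Y hY x hx y hy
        rw [← hin, ← hin]
        exact h _ hY _ ⟨x, hx, rfl⟩ _ ⟨y, hy, rfl⟩
      · intro h X hX x hx y hy
        have hXH := (A.isASet_iff _).1 hH X hX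
        by_cases hxH : x ∈ H
        · have hsub := hXH x hx hxH
          have him : (Subtype.val '' (Subtype.val ⁻¹' X : Set H) : Set G) = X := by
            exact Set.image_preimage_eq_of_subset fun x hx => ⟨⟨x, hsub hx⟩, rfl⟩
          have := h (Subtype.val ⁻¹' X) (show (Subtype.val '' (Subtype.val ⁻¹' X : Set H) : Set G) ∈ A.basicSets by
              rw [him]; exact hX)
            ⟨x, hxH⟩ hx ⟨y, hsub hy⟩ hy
          rw [← hin, ← hin] at this
          exact this
        · have hyH : y ∉ H := fun hyH => hxH (hXH y hy hyH hx)
          rw [hout x hxH, hout y hyH] }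

/-- Transport of an S-ring along a group isomorphism. -/
def map {G' : Type*} [AddCommGroup G'] [Finite G'] (A : SchurRing G) (e : G ≃+ G') :
    SchurRing G' :=
  have hpart : Setoid.IsPartition ((fun X : Set G => e '' X) '' A.basicSets) := by
    refine ⟨?_, fun g => ?_⟩
    · rintro ⟨X, hX, h⟩
      exact A.isPartition.1 (by rwa [Set.image_eq_empty.1 h] at hX)
    · obtain ⟨X, ⟨hX, hgX⟩, huniq⟩ := A.isPartition.2 (e.symm g)
      refine ⟨e '' X, ⟨⟨X, hX, rfl⟩, ⟨_, hgX, by simp⟩⟩, ?_⟩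
      rintro _ ⟨⟨Y, hY, rfl⟩, ⟨y, hy, rfl⟩⟩
      rw [huniq Y ⟨hY, by simpa using hy⟩]
  { toSubring := A.toSubring.map (AddMonoidAlgebra.mapDomainRingHom ℤ (e : G →+ G'))
    basicSets := (fun X : Set G => e '' X) '' A.basicSets
    isPartition := hpart
    zero_basic := ⟨{0}, A.zero_basic, by simp⟩
    neg_basic := by
      rintro _ ⟨X, hX, rfl⟩
      exact ⟨-X, A.neg_basic X hX, Set.image_neg_of_apply_neg_eq_neg (fun x _ => map_neg e x)⟩
    span_basic := by
      have hco : ∀ (f : AddMonoidAlgebra ℤ G) (x : G),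
          (AddMonoidAlgebra.mapDomainRingHom ℤ (e : G →+ G') f).coeff (e x) = f.coeff x :=
        fun f x => Finsupp.mapDomain_apply e.injective _ x
      have hinv : ∀ f : AddMonoidAlgebra ℤ G',
          AddMonoidAlgebra.mapDomainRingHom ℤ (e : G →+ G')
            (AddMonoidAlgebra.mapDomainRingHom ℤ (e.symm : G' →+ G) f) = f := by
        intro f
        ext g
        obtain ⟨x, rfl⟩ := e.surjective g
        rw [hco]
        have := Finsupp.mapDomain_apply e.symm.injective f.coeff (e x)
        rw [e.symm_apply_apply] at this
        exact this
      ext f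
      rw [mem_closure_xi_iff hpart]
      constructor
      · rintro ⟨f, hf, rfl⟩ _ ⟨X, hX, rfl⟩ _ ⟨x, hx, rfl⟩ _ ⟨y, hy, rfl⟩
        change (AddMonoidAlgebra.mapDomainRingHom ℤ (e : G →+ G') f).coeff (e x) =
          (AddMonoidAlgebra.mapDomainRingHom ℤ (e : G →+ G') f).coeff (e y)
        rw [hco, hco]
        exact (A.mem_iff f).1 hf X hX x hx y hy
      · intro h
        refine ⟨AddMonoidAlgebra.mapDomainRingHom ℤ (e.symm : G' →+ G) f, ?_, hinv f⟩
        refine (A.mem_iff _).2 fun X hX x hx y hy => ?_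
        rw [← hco, ← hco, hinv]
        exact h _ ⟨X, hX, rfl⟩ _ ⟨x, hx, rfl⟩ _ ⟨y, hy, rfl⟩ }

/-- The tensor product `A₁ ⊗ A₂` of S-rings over `G₁` and `G₂`: the image of `A₁ ⊗ A₂` in
`ℤ[G₁] ⊗ ℤ[G₂] = ℤ[G₁ × G₂]`, with basic sets `X₁ × X₂`. -/
def tensor {G₁ G₂ : Type*} [AddCommGroup G₁] [Finite G₁] [AddCommGroup G₂] [Finite G₂]
    (A₁ : SchurRing G₁) (A₂ : SchurRing G₂) : SchurRing (G₁ × G₂) :=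
  let ι₁ := AddMonoidAlgebra.mapDomainRingHom ℤ (AddMonoidHom.inl G₁ G₂)
  let ι₂ := AddMonoidAlgebra.mapDomainRingHom ℤ (AddMonoidHom.inr G₁ G₂)
  let T : Set (AddMonoidAlgebra ℤ (G₁ × G₂)) :=
    {f | ∃ a ∈ A₁.toSubring, ∃ b ∈ A₂.toSubring, f = ι₁ a * ι₂ b}
  { carrier := AddSubgroup.closure T
    zero_mem' := AddSubgroup.zero_mem _
    add_mem' := AddSubgroup.add_mem _
    neg_mem' := AddSubgroup.neg_mem _
    one_mem' := AddSubgroup.subset_closure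
      ⟨1, A₁.toSubring.one_mem, 1, A₂.toSubring.one_mem, by simp⟩
    mul_mem' := by
      intro f g hf hg
      have hf' : f ∈ AddSubgroup.closure T := hf
      have hg' : g ∈ AddSubgroup.closure T := hg
      clear hf hg
      change f * g ∈ AddSubgroup.closure T
      induction hf' using AddSubgroup.closure_induction with
      | mem f hf =>
        induction hg' using AddSubgroup.closure_induction with
        | mem g hg =>
          obtain ⟨a, ha, b, hb, rfl⟩ := hf
          obtain ⟨c, hc, d, hd, rfl⟩ := hg
          refine AddSubgroup.subset_closure ⟨a * c, A₁.toSubring.mul_mem ha hc, b * d,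
            A₂.toSubring.mul_mem hb hd, ?_⟩
          rw [map_mul, map_mul]
          ring
        | zero => simp
        | add x y _ _ hx hy =>
          rw [mul_add]
          exact AddSubgroup.add_mem _ hx hy
        | neg x _ hx =>
          rw [mul_neg]
          exact AddSubgroup.neg_mem _ hx
      | zero => simp
      | add x y _ _ hx hy =>
        rw [add_mul]
        exact AddSubgroup.add_mem _ hx hy
      | neg x _ hx =>
        rw [neg_mul]
        exact AddSubgroup.neg_mem _ hx
    basicSets := {Z | ∃ X₁ ∈ A₁.basicSets, ∃ X₂ ∈ A₂.basicSets, Z = X₁ ×ˢ X₂}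
    isPartition := by
      refine ⟨?_, ?_⟩
      · rintro ⟨X, hX, Y, hY, h⟩
        rcases Set.prod_eq_empty_iff.1 h.symm with rfl | rfl
        · exact A₁.isPartition.1 hX
        · exact A₂.isPartition.1 hY
      · rintro ⟨x, y⟩
        obtain ⟨X, ⟨hX, hx⟩, hXu⟩ := A₁.isPartition.2 x
        obtain ⟨Y, ⟨hY, hy⟩, hYu⟩ := A₂.isPartition.2 y
        refine ⟨X ×ˢ Y, ⟨⟨X, hX, Y, hY, rfl⟩, ⟨hx, hy⟩⟩, ?_⟩
        rintro _ ⟨⟨X', hX', Y', hY', rfl⟩, ⟨hx', hy'⟩⟩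
        rw [hXu X' ⟨hX', hx'⟩, hYu Y' ⟨hY', hy'⟩]
    zero_basic := ⟨{0}, A₁.zero_basic, {0}, A₂.zero_basic, by
      rw [Set.singleton_prod_singleton]
      rfl⟩
    neg_basic := by
      rintro _ ⟨X, hX, Y, hY, rfl⟩
      exact ⟨-X, A₁.neg_basic X hX, -Y, A₂.neg_basic Y hY, rfl⟩
    span_basic := by
      have hmul : ∀ (X : Set G₁) (Y : Set G₂), ι₁ (xi X) * ι₂ (xi Y) = xi (X ×ˢ Y) := by
        intro X Y
        have hs : (Set.toFinite (X ×ˢ Y)).toFinset =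
            (Set.toFinite X).toFinset ×ˢ (Set.toFinite Y).toFinset := by
          ext
          simp
        unfold xi
        rw [finsum_mem_eq_finite_toFinset_sum _ (Set.toFinite X),
          finsum_mem_eq_finite_toFinset_sum _ (Set.toFinite Y),
          finsum_mem_eq_finite_toFinset_sum _ (Set.toFinite (X ×ˢ Y)), hs,
          map_sum, map_sum, Finset.sum_mul_sum, Finset.sum_product]
        refine Finset.sum_congr rfl fun x _ => Finset.sum_congr rfl fun y _ => ?_
        simp [ι₁, ι₂, AddMonoidAlgebra.single_mul_single]
      change AddSubgroup.closure T = _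
      apply le_antisymm
      · rw [AddSubgroup.closure_le]
        rintro _ ⟨a, ha, b, hb, rfl⟩
        have ha' : a ∈ AddSubgroup.closure (xi '' A₁.basicSets) := A₁.span_basic ▸ ha
        have hb' : b ∈ AddSubgroup.closure (xi '' A₂.basicSets) := A₂.span_basic ▸ hb
        clear ha hb
        rw [SetLike.mem_coe]
        induction ha' using AddSubgroup.closure_induction with
        | mem a ha =>
          obtain ⟨X, hX, rfl⟩ := ha
          induction hb' using AddSubgroup.closure_induction with
          | mem b hb =>
            obtain ⟨Y, hY, rfl⟩ := hb
            exact AddSubgroup.subset_closure ⟨_, ⟨X, hX, Y, hY, rfl⟩, (hmul X Y).symm⟩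
          | zero => simp
          | add x y _ _ hx hy =>
            rw [map_add, mul_add]
            exact AddSubgroup.add_mem _ hx hy
          | neg x _ hx =>
            rw [map_neg, mul_neg]
            exact AddSubgroup.neg_mem _ hx
        | zero => simp
        | add x y _ _ hx hy =>
          rw [map_add, add_mul]
          exact AddSubgroup.add_mem _ hx hy
        | neg x _ hx =>
          rw [map_neg, neg_mul]
          exact AddSubgroup.neg_mem _ hx
      · apply AddSubgroup.closure_mono
        rintro _ ⟨_, ⟨X, hX, Y, hY, rfl⟩, rfl⟩
        exact ⟨xi X, A₁.xi_mem hX, xi Y, A₂.xi_mem hY, (hmul X Y).symm⟩ }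

end SchurRing

/-! ### Components of a finite commutative ring and CG-rings -/

section Components

variable (R : Type*) [CommRing R]

/-- The component `R_Q` for a set `Q` of primes: the elements whose additive order is divisible only
by primes from `Q`, i.e. the sum of the Sylow `p`-subgroups of `R` with `p ∈ Q`. -/
def componentIdeal (Q : Set ℕ) : Ideal R where
  carrier := {x | ∀ p : ℕ, p.Prime → p ∣ addOrderOf x → p ∈ Q}
  zero_mem' := by
    intro p hp h
    rw [addOrderOf_zero] at h
    exact absurd (Nat.dvd_one.1 h) hp.ne_one
  add_mem' := by
    intro x y hx hy p hp h
    have h1 : p ∣ addOrderOf x * addOrderOf y :=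
      h.trans ((AddCommute.all x y).addOrderOf_add_dvd_lcm.trans (Nat.lcm_dvd_mul _ _))
    rcases (hp.dvd_mul).1 h1 with h2 | h2
    · exact hx p hp h2
    · exact hy p hp h2
  smul_mem' := by
    intro r x hx p hp h
    exact hx p hp (h.trans (addOrderOf_map_dvd (AddMonoidHom.mulLeft r) x))

/-- `R_Q` as a type; it is a ring with identity `1_Q`. -/
def Component (Q : Set ℕ) : Type _ := componentIdeal R Q

theorem exists_component_one [Finite R] (Q : Set ℕ) :
    ∃ e ∈ componentIdeal R Q, ∀ x ∈ componentIdeal R Q, e * x = x := by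
  have split : ∀ n : ℕ, n ≠ 0 → ∃ a b : ℕ, n = a * b ∧ (∀ p, p.Prime → p ∣ a → p ∈ Q) ∧
      (∀ p, p.Prime → p ∣ b → p ∉ Q) := by
    intro n
    induction n using Nat.recOnMul with
    | zero => intro h; exact absurd rfl h
    | one =>
      intro _
      exact ⟨1, 1, rfl, fun p hp h => absurd (Nat.dvd_one.1 h) hp.ne_one,
        fun p hp h => absurd (Nat.dvd_one.1 h) hp.ne_one⟩
    | prime q hq =>
      intro _
      by_cases hQ : q ∈ Q
      · exact ⟨q, 1, (mul_one q).symm, fun p hp h => ((Nat.prime_dvd_prime_iff_eq hp hq).1 h) ▸ hQ,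
          fun p hp h => absurd (Nat.dvd_one.1 h) hp.ne_one⟩
      · exact ⟨1, q, (one_mul q).symm, fun p hp h => absurd (Nat.dvd_one.1 h) hp.ne_one,
          fun p hp h => ((Nat.prime_dvd_prime_iff_eq hp hq).1 h) ▸ hQ⟩
    | mul m n hm hn =>
      intro h
      obtain ⟨a, b, hab, ha, hb⟩ := hm (left_ne_zero_of_mul h)
      obtain ⟨c, d, hcd, hc, hd⟩ := hn (right_ne_zero_of_mul h)
      refine ⟨a * c, b * d, by rw [hab, hcd]; ring, fun p hp h => ?_, fun p hp h => ?_⟩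
      · exact (hp.dvd_mul.1 h).elim (ha p hp) (hc p hp)
      · exact (hp.dvd_mul.1 h).elim (hb p hp) (hd p hp)
  obtain ⟨a, b, hab, ha, hb⟩ := split (Nat.card R) Nat.card_pos.ne'
  have hcop : Nat.Coprime a b :=
    Nat.coprime_of_dvd fun p hp h1 h2 => hb p hp h2 (ha p hp h1)
  obtain ⟨u, v, huv⟩ := (Nat.isCoprime_iff_coprime.2 hcop : IsCoprime (a : ℤ) (b : ℤ))
  have hcard : ((a : R) * (b : R)) = 0 := by
    rw [← Nat.cast_mul, ← hab]
    simpa using (card_nsmul_eq_zero' (G := R) (x := (1 : R)))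
  have h1 : (u : R) * (a : R) + (v : R) * (b : R) = 1 := by
    exact_mod_cast congrArg (Int.cast : ℤ → R) huv
  refine ⟨(v : R) * (b : R), ?_, ?_⟩
  · intro p hp h
    refine ha p hp (h.trans (addOrderOf_dvd_of_nsmul_eq_zero ?_))
    rw [nsmul_eq_mul]
    linear_combination (v : R) * hcard
  · intro x hx
    have hax : (a : R) * x = 0 := by
      have hord : addOrderOf x ∣ a * b := hab ▸ addOrderOf_dvd_natCard x
      have hc : Nat.Coprime (addOrderOf x) b :=
        Nat.coprime_of_dvd fun p hp h1 h2 => hb p hp h2 (hx p hp h1)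
      have := addOrderOf_dvd_iff_nsmul_eq_zero.1 (hc.dvd_of_dvd_mul_right hord)
      rwa [nsmul_eq_mul] at this
    linear_combination x * h1 - (u : R) * hax

/-- The identity `1_Q` of `R_Q`, i.e. the `Q`-projection of `1`. -/
def componentOne [Finite R] (Q : Set ℕ) : R := (exists_component_one R Q).choose

theorem componentOne_mem [Finite R] (Q : Set ℕ) : componentOne R Q ∈ componentIdeal R Q :=
  (exists_component_one R Q).choose_spec.1

theorem componentOne_mul [Finite R] (Q : Set ℕ) {x : R} (hx : x ∈ componentIdeal R Q) :
    componentOne R Q * x = x :=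
  (exists_component_one R Q).choose_spec.2 x hx

/-- Addition and multiplication of `R_Q` are those of `R`. -/
instance componentCommRing [Finite R] (Q : Set ℕ) : CommRing (Component R Q) :=
  { (inferInstance : AddCommGroup (componentIdeal R Q)) with
    mul := fun x y => ⟨x.1 * y.1, (componentIdeal R Q).mul_mem_left x.1 y.2⟩
    one := ⟨componentOne R Q, componentOne_mem R Q⟩
    mul_assoc := fun x y z => Subtype.ext (mul_assoc x.1 y.1 z.1)
    mul_comm := fun x y => Subtype.ext (mul_comm x.1 y.1)
    one_mul := fun x => Subtype.ext (componentOne_mul R Q x.2)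
    mul_one := fun x => Subtype.ext ((mul_comm _ _).trans (componentOne_mul R Q x.2))
    left_distrib := fun x y z => Subtype.ext (mul_add x.1 y.1 z.1)
    right_distrib := fun x y z => Subtype.ext (add_mul x.1 y.1 z.1)
    zero_mul := fun x => Subtype.ext (zero_mul x.1)
    mul_zero := fun x => Subtype.ext (mul_zero x.1) }

/-- A Galois ring: a finite local ring `S` whose radical is `pS` for a prime `p`. -/
def IsGaloisRing (S : Type*) [CommRing S] : Prop :=
  Finite S ∧ IsLocalRing S ∧
    ∃ p : ℕ, p.Prime ∧ Ideal.jacobson (⊥ : Ideal S) = Ideal.span {(p : S)}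

/-- A CG-ring (componentwise Galois ring): all `p`-components `R_p`, for the primes `p` dividing
`|R|`, are Galois rings. -/
def IsCGRing [Finite R] : Prop :=
  ∀ p ∈ (Nat.card R).primeFactors, IsGaloisRing (Component R {p})

/-- The group `R_Q^×` viewed as a subgroup of `R^× = R_Q^× × R_{Q'}^×`: the units of `R` whose
component outside `Q` is `1`. -/
def componentUnits (Q : Set ℕ) : Subgroup Rˣ where
  carrier := {u | (u : R) - 1 ∈ componentIdeal R Q}
  one_mem' := by simp
  mul_mem' := by
    intro u v hu hv
    have h : ((u * v : Rˣ) : R) - 1 = (v : R) * ((u : R) - 1) + ((v : R) - 1) := by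
      push_cast
      ring
    change ((u * v : Rˣ) : R) - 1 ∈ componentIdeal R Q
    rw [h]
    exact Ideal.add_mem _ (Ideal.mul_mem_left _ _ hu) hv
  inv_mem' := by
    intro u hu
    have h : ((u⁻¹ : Rˣ) : R) - 1 = (-(u⁻¹ : Rˣ) : R) * ((u : R) - 1) := by
      have := u.inv_mul
      linear_combination this
    change ((u⁻¹ : Rˣ) : R) - 1 ∈ componentIdeal R Q
    rw [h]
    exact Ideal.mul_mem_left _ _ hu

/-- The members of `componentUnits R Q` are exactly the units of the ring `R_Q`, completed by the
identity of the complementary component. -/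
theorem mem_componentUnits_iff [Finite R] (Q : Set ℕ) (u : Rˣ) :
    u ∈ componentUnits R Q ↔
      ∃ v : (Component R Q)ˣ, (u : R) = (v : Component R Q).1 + (1 - componentOne R Q) := by
  set e := componentOne R Q with he
  have he1 : e * e = e := componentOne_mul R Q (componentOne_mem R Q)
  constructor
  · intro hu
    have hu1 : e * ((u : R) - 1) = (u : R) - 1 := componentOne_mul R Q hu
    have hm : ∀ r : R, e * r ∈ componentIdeal R Q := fun r =>
      Ideal.mul_mem_right r _ (componentOne_mem R Q)
    refine ⟨⟨⟨e * u, hm _⟩, ⟨e * (u⁻¹ : Rˣ), hm _⟩, Subtype.ext ?_, Subtype.ext ?_⟩, ?_⟩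
    · change (e * u) * (e * (u⁻¹ : Rˣ)) = e
      have := u.mul_inv
      linear_combination (e * e) * this + he1
    · change (e * (u⁻¹ : Rˣ)) * (e * u) = e
      have := u.mul_inv
      linear_combination (e * e) * this + he1
    · change (u : R) = e * u + (1 - e)
      linear_combination -hu1
  · rintro ⟨v, hv⟩
    have : (u : R) - 1 = (v : Component R Q).1 - e := by rw [hv]; ring
    change (u : R) - 1 ∈ componentIdeal R Q
    rw [this]
    exact Ideal.sub_mem _ (v : Component R Q).2 (componentOne_mem R Q)

/-- A set `X ⊆ R` is `Q`-rational if `R_Q^× X = X`. -/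
def IsQRational {R : Type*} [CommRing R] (Q : Set ℕ) (X : Set R) : Prop :=
  (componentUnits R Q : Set Rˣ) • X = X

/-- `I_L(X)`: the largest ideal `K` of `R` with `X + K = X`. -/
def lowerIdeal {R : Type*} [CommRing R] (X : Set R) : Ideal R :=
  sSup {K : Ideal R | X + (K : Set R) = X}

theorem isGreatest_lowerIdeal {R : Type*} [CommRing R] (X : Set R) :
    IsGreatest {K : Ideal R | X + (K : Set R) = X} (lowerIdeal X) := by
  refine ⟨?_, fun K hK => le_sSup hK⟩
  have hle : ∀ k ∈ lowerIdeal X, ∀ x ∈ X, x + k ∈ X := by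
    intro k hk
    unfold lowerIdeal at hk
    rw [sSup_eq_iSup'] at hk
    induction hk using Submodule.iSup_induction' with
    | mem K k hk =>
      intro x hx
      have h : X + ((K : Ideal R) : Set R) = X := K.2
      rw [← h]
      exact Set.add_mem_add hx hk
    | zero => intro x hx; simpa using hx
    | add a b _ _ ha hb =>
      intro x hx
      rw [← add_assoc]
      exact hb _ (ha x hx)
  apply Set.Subset.antisymm
  · rintro _ ⟨x, hx, k, hk, rfl⟩
    exact hle k hk x hx
  · intro x hx
    exact ⟨x, hx, 0, (lowerIdeal X).zero_mem, add_zero x⟩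

end Components

/-! ### S-rings over a finite commutative ring -/

namespace SchurRing

variable {R : Type*} [CommRing R] [Finite R]

/-- `A` is an S-ring over the ring `R`: an S-ring over the additive group of `R` whose basic sets are
permuted by multiplication by units. -/
def IsOverRing (A : SchurRing R) : Prop :=
  ∀ u : Rˣ, ∀ X ∈ A.basicSets, u • X ∈ A.basicSets

/-- `A`-ideals: ideals of `R` that are `A`-sets. -/
def IsAIdeal (A : SchurRing R) (I : Ideal R) : Prop := A.IsASet (I : Set R)

/-- Maximal `A`-ideals: maximal elements of the set of `A`-ideals other than `R`. -/
def IsMaximalAIdeal (A : SchurRing R) (I : Ideal R) : Prop :=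
  Maximal (fun K : Ideal R => A.IsAIdeal K ∧ K ≠ ⊤) I

/-- The `I/J`-condition. -/
def SatisfiesCondition (A : SchurRing R) (I J : Ideal R) : Prop :=
  A.IsAIdeal I ∧ A.IsAIdeal J ∧
    ∀ X ∈ A.basicSets, X ⊆ (I : Set R)ᶜ → J ≤ lowerIdeal X ⊓ I

/-- The smallest `A`-ideal containing `R_Q`: the intersection of all `A`-ideals containing it. -/
def star (A : SchurRing R) (Q : Set ℕ) : Ideal R :=
  sInf {K : Ideal R | A.IsAIdeal K ∧ componentIdeal R Q ≤ K}

theorem isAIdeal_star (A : SchurRing R) (Q : Set ℕ) : A.IsAIdeal (A.star Q) := by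
  refine (A.isASet_iff _).2 fun Y hY y hy hyI z hz => ?_
  have hyI' : y ∈ sInf {K : Ideal R | A.IsAIdeal K ∧ componentIdeal R Q ≤ K} := hyI
  change z ∈ sInf {K : Ideal R | A.IsAIdeal K ∧ componentIdeal R Q ≤ K}
  rw [Submodule.mem_sInf] at hyI' ⊢
  exact fun K hK => (A.isASet_iff _).1 hK.1 Y hY y hy (hyI' K hK) hz

/-- The S-ring `A_I` over the additive group of an `A`-ideal `I`. -/
def restrictIdeal (A : SchurRing R) (I : Ideal R) (hI : A.IsAIdeal I) : SchurRing I :=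
  A.restrict I.toAddSubgroup hI

end SchurRing

end

/-! In a Galois ring every non-zero element is a power of `p` times a unit. Hence, as long as
neither `p`-component vanishes, adding an element of order `p` amounts to multiplying by a unit of
`R_p` (`IsCGRing.exists_unit_sub_mem`). So rationality makes basic sets outside `I` almost invariant
under the `p`-torsion `E`, for `p ∈ Q`: a coset of `E` has at most one exceptional point (zero
`p`-component), and a basic set outside `I` contains all or none of the others. This is
`IsTorsionSaturated`, and it also holds for the images in quotients.

A basic set `X ⊄ I` thus meets a coset of `E` in 0, 1, `|E| - 1` or `|E|` points. Reducing `xi X ^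
p` modulo `p` makes the exceptional counts visible: the `g` having a number of `p`-th parts in `X`
prime to `p` form an `A`-set of elements of order prime to `p`, and maximality forces it into `I`.
Therefore any `p`-torsion inside `I` already translates every such `X` to itself.

Let `K` be the `A`-ideal of all translations fixing the basic sets outside `I`. In `R/K` none but 0
remains, so the image of `I` has no `p`-torsion for `p ∈ Q`. Fix `s` of order `p` there. Each outer
basic set has an `A`-set as its fibre over `s` (`isASet_fibre`) and meets all cosets of `I` outside
`I` equally often. A convolution count carries the fibre unchanged along the block of `s`, so that
block is a transversal of the non-zero cosets of `I`. It lies in the `Q`-component, which is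
therefore an `A`-ideal disjoint from the image of `I` (`isAIdeal_componentIdeal`). Pulling back to
`R` gives `I ⊓ A.star Q ≤ K`, the `I/J`-condition. If `J = 0`, the fibre argument runs in `R` itself
and shows that sums of basic sets are basic. -/

/-! ### Convolution and Frobenius in the group ring -/

theorem coeff_mul_eq_sum {G : Type*} [AddCommGroup G] [Fintype G] (f g : AddMonoidAlgebra ℤ G)
    (x : G) : (f * g).coeff x = ∑ y, f.coeff y * g.coeff (x - y) := by
  rw [AddMonoidAlgebra.coeff_mul_apply_left, Finsupp.sum_fintype _ _ (by simp)]
  simp [neg_add_eq_sub]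

theorem coeff_xi_mul_xi {G : Type*} [AddCommGroup G] [Finite G] (X Y : Set G) (g : G) :
    (xi X * xi Y).coeff g = ({x | x ∈ X ∧ g - x ∈ Y} : Set G).ncard := by
  classical
  have := Fintype.ofFinite G
  rw [coeff_mul_eq_sum, Set.ncard_eq_toFinset_card']
  simp [coeff_xi, ← ite_and, and_comm]

/-- Modulo a prime `p`, the `p`-th power of `xi X` is the sum of the elements `p • x`, `x ∈ X`. -/
theorem coeff_xi_pow_prime {G : Type*} [AddCommGroup G] [Finite G] (X : Set G) {p : ℕ}
    (hp : p.Prime) (g : G) :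
    (((xi X ^ p).coeff g : ℤ) : ZMod p) = (({x | x ∈ X ∧ p • x = g} : Set G).ncard : ZMod p) := by
  classical
  have := Fintype.ofFinite G
  have : Fact p.Prime := ⟨hp⟩
  let φ := AddMonoidAlgebra.mapRingHom G (Int.castRingHom (ZMod p))
  have hcoeff : ∀ f : AddMonoidAlgebra ℤ G, ((f.coeff g : ℤ) : ZMod p) = (φ f).coeff g := by
    intro f
    simp [φ]
  have hxi : φ (xi X) = ∑ x ∈ X.toFinset, AddMonoidAlgebra.single x (1 : ZMod p) := by
    unfold xi
    rw [finsum_mem_eq_finite_toFinset_sum _ (Set.toFinite X), map_sum]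
    simp [φ]
  have : CharP (AddMonoidAlgebra (ZMod p) G) p :=
    charP_of_injective_algebraMap (R := ZMod p)
      (FaithfulSMul.algebraMap_injective _ _) p
  -- In characteristic `p` the `p`-th power is additive, and it sends the basis element of `x` to
  -- that of `p • x`.
  rw [hcoeff, map_pow, hxi, sum_pow_char p, AddMonoidAlgebra.coeff_sum, Finsupp.finsetSum_apply,
    Set.ncard_eq_toFinset_card']
  simp only [AddMonoidAlgebra.single_pow, AddMonoidAlgebra.coeff_single, Finsupp.single_apply,
    one_pow, Finset.sum_boole]
  congr 2
  ext
  simp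

/-! ### Calculus of `A`-sets and quotient S-rings -/

namespace SchurRing

variable {G : Type*} [AddCommGroup G] [Finite G] (A : SchurRing G)

/-- The basic set containing a given element. -/
def block (g : G) : Set G := (A.isPartition.2 g).choose

theorem block_mem (g : G) : A.block g ∈ A.basicSets := (A.isPartition.2 g).choose_spec.1.1

theorem mem_block (g : G) : g ∈ A.block g := (A.isPartition.2 g).choose_spec.1.2

variable {A}

theorem block_eq {X : Set G} (hX : X ∈ A.basicSets) {g : G} (hg : g ∈ X) : A.block g = X :=
  (A.isPartition.2 g).unique ⟨A.block_mem g, A.mem_block g⟩ ⟨hX, hg⟩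

theorem block_eq_of_mem {x y : G} (h : y ∈ A.block x) : A.block y = A.block x :=
  block_eq (A.block_mem x) h

theorem block_zero : A.block 0 = {0} := block_eq A.zero_basic rfl

theorem eq_of_basicSets_subset {B : SchurRing G} (h : B.basicSets ⊆ A.basicSets) : A = B := by
  have hb : A.basicSets = B.basicSets := by
    refine Set.Subset.antisymm (fun X hX => ?_) h
    obtain ⟨x, hx⟩ := Setoid.nonempty_of_mem_partition A.isPartition hX
    rw [← block_eq hX hx, block_eq (h (B.block_mem x)) (B.mem_block x)]
    exact B.block_mem x
  apply ext_toSubring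
  ext f
  rw [A.mem_iff, B.mem_iff, hb]

theorem isASet_iff_block {X : Set G} : A.IsASet X ↔ ∀ x ∈ X, A.block x ⊆ X := by
  rw [isASet_iff]
  exact ⟨fun h x hx => h _ (A.block_mem x) x (A.mem_block x) hx,
    fun h Y hY y hy hyX => block_eq hY hy ▸ h y hyX⟩

theorem IsASet.subset {X Y : Set G} (hX : A.IsASet X) (hY : Y ∈ A.basicSets) {y : G} (hy : y ∈ Y)
    (hyX : y ∈ X) : Y ⊆ X :=
  (A.isASet_iff X).1 hX Y hY y hy hyX

theorem isASet_of_forall_exists {X : Set G} (h : ∀ x ∈ X, ∃ W, A.IsASet W ∧ x ∈ W ∧ W ⊆ X) :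
    A.IsASet X := by
  refine isASet_iff_block.2 fun x hx => ?_
  obtain ⟨W, hW, hxW, hWX⟩ := h x hx
  exact (isASet_iff_block.1 hW x hxW).trans hWX

theorem isASet_of_mem {X : Set G} (hX : X ∈ A.basicSets) : A.IsASet X :=
  ⟨{X}, by simpa using hX, by simp⟩

theorem isASet_block (g : G) : A.IsASet (A.block g) := isASet_of_mem (A.block_mem g)

theorem isASet_coeff {f : AddMonoidAlgebra ℤ G} (hf : f ∈ A.toSubring) (P : ℤ → Prop) :
    A.IsASet {g | P (f.coeff g)} := by
  refine (A.isASet_iff _).2 fun Y hY y hy hyP z hz => ?_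
  have := (A.mem_iff f).1 hf Y hY y hy z hz
  simp only [Set.mem_ofPred_eq] at hyP ⊢
  rwa [← this]

theorem IsASet.xi_mem {X : Set G} (hX : A.IsASet X) : xi X ∈ A.toSubring := by
  classical
  refine (A.mem_iff _).2 fun Y hY x hx y hy => ?_
  have : x ∈ X ↔ y ∈ X := ⟨fun h => hX.subset hY hx h hy, fun h => hX.subset hY hy h hx⟩
  simp [coeff_xi, this]

theorem IsASet.inter {X Y : Set G} (hX : A.IsASet X) (hY : A.IsASet Y) : A.IsASet (X ∩ Y) :=
  isASet_iff_block.2 fun x hx => Set.subset_inter (isASet_iff_block.1 hX x hx.1)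
    (isASet_iff_block.1 hY x hx.2)

theorem IsASet.neg {X : Set G} (hX : A.IsASet X) : A.IsASet (-X) := by
  refine isASet_of_forall_exists fun x hx => ⟨-A.block (-x), ?_, ?_, ?_⟩
  · exact isASet_of_mem (A.neg_basic _ (A.block_mem _))
  · simpa using A.mem_block (-x)
  · exact Set.neg_subset_neg.2 (isASet_iff_block.1 hX _ hx)

/-- The number of representations `g = x + y` with `x ∈ X`, `y ∈ Y` is constant on basic sets. -/
theorem IsASet.ncard_eq {X Y : Set G} (hX : A.IsASet X) (hY : A.IsASet Y) {Z : Set G}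
    (hZ : Z ∈ A.basicSets) {g h : G} (hg : g ∈ Z) (hh : h ∈ Z) :
    ({x | x ∈ X ∧ g - x ∈ Y} : Set G).ncard = ({x | x ∈ X ∧ h - x ∈ Y} : Set G).ncard := by
  have := (A.mem_iff _).1 (A.toSubring.mul_mem hX.xi_mem hY.xi_mem) Z hZ g hg h hh
  rw [coeff_xi_mul_xi, coeff_xi_mul_xi] at this
  exact_mod_cast this

/-- The coefficients of `xi X * xi Y` count representations, so `X + Y` is the support of an element
of `A`. -/
theorem IsASet.add {X Y : Set G} (hX : A.IsASet X) (hY : A.IsASet Y) : A.IsASet (X + Y) := by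
  have h := isASet_coeff (A.toSubring.mul_mem hX.xi_mem hY.xi_mem) (fun n => n ≠ 0)
  convert h using 1
  ext g
  simp only [coeff_xi_mul_xi, Set.mem_ofPred_eq, Set.mem_add]
  rw [Nat.cast_ne_zero, ← Nat.pos_iff_ne_zero, Set.ncard_pos]
  constructor
  · rintro ⟨x, hx, y, hy, rfl⟩
    exact ⟨x, hx, by simpa using hy⟩
  · rintro ⟨x, hx, hy⟩
    exact ⟨x, hx, _, hy, by abel⟩

/-- For a prime `p`, the elements having a number prime to `p` of `p`-th parts in an `A`-set form an
`A`-set. -/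
theorem IsASet.primePower {X : Set G} (hX : A.IsASet X) {p : ℕ} (hp : p.Prime) :
    A.IsASet {g | ¬ p ∣ ({x | x ∈ X ∧ p • x = g} : Set G).ncard} := by
  have h := isASet_coeff (A.toSubring.pow_mem hX.xi_mem p) (fun n => ((n : ℤ) : ZMod p) ≠ 0)
  convert h using 1
  ext g
  rw [Set.mem_ofPred_eq, Set.mem_ofPred_eq, coeff_xi_pow_prime X hp, Ne, ZMod.natCast_eq_zero_iff]

/-- The coefficient of `xi X * xi (-X)` at `g` is `|X ∩ (g + X)|`; it equals `|X|` exactly when `g`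
stabilizes `X`. -/
theorem IsASet.stabilizer {X : Set G} (hX : A.IsASet X) :
    A.IsASet (AddAction.stabilizer G X : Set G) := by
  have h := isASet_coeff (A.toSubring.mul_mem hX.xi_mem hX.neg.xi_mem) (fun n => n = X.ncard)
  convert h using 1
  ext g
  simp only [coeff_xi_mul_xi, Set.mem_ofPred_eq, SetLike.mem_coe, AddAction.mem_stabilizer_iff,
    Set.mem_neg, neg_sub]
  have hsub : ({x | x ∈ X ∧ x - g ∈ X} : Set G) = X ∩ (g +ᵥ X) := by
    ext x
    simp [Set.mem_vadd_set_iff_neg_vadd_mem, neg_add_eq_sub]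
  rw [hsub, Nat.cast_inj]
  constructor
  · intro h
    rw [h, Set.inter_self]
  · intro h
    have h1 : X ∩ (g +ᵥ X) = X :=
      Set.eq_of_subset_of_ncard_le Set.inter_subset_left h.ge
    have h2 : X ⊆ g +ᵥ X := Set.inter_eq_left.1 h1
    exact (Set.eq_of_subset_of_ncard_le h2 (by simp [Set.ncard_vadd_set])).symm

/-- The image of an S-ring under a surjective homomorphism whose kernel is an `A`-subgroup. -/
noncomputable def pushforward {G' : Type*} [AddCommGroup G'] [Finite G'] (A : SchurRing G)
    (π : G →+ G') (hπ : Function.Surjective π) (hker : A.IsASubgroup π.ker) : SchurRing G' :=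
  -- The `A`-set `A.block x + ker π` contains `y`, hence the whole block of `y`.
  have hsub : ∀ x y, π x = π y → π '' A.block y ⊆ π '' A.block x := by
    rintro x y hxy _ ⟨z, hz, rfl⟩
    have hK : A.IsASet (A.block x + (π.ker : Set G)) := (isASet_block x).add hker
    have hy : y ∈ A.block x + (π.ker : Set G) :=
      ⟨x, A.mem_block x, y - x, by simp [AddMonoidHom.mem_ker, hxy],
        add_sub_cancel x y⟩
    obtain ⟨w, hw, k, hk, rfl⟩ := hK.subset (A.block_mem y) (A.mem_block y) hy hz
    exact ⟨w, hw, by rw [map_add, (AddMonoidHom.mem_ker).1 hk, add_zero]⟩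
  have hpart : Setoid.IsPartition ((fun X : Set G => π '' X) '' A.basicSets) := by
    refine ⟨?_, fun g => ?_⟩
    · rintro ⟨X, hX, h⟩
      exact A.isPartition.1 (by rwa [Set.image_eq_empty.1 h] at hX)
    · obtain ⟨x, rfl⟩ := hπ g
      refine ⟨π '' A.block x, ⟨⟨_, A.block_mem x, rfl⟩, ⟨x, A.mem_block x, rfl⟩⟩, ?_⟩
      rintro _ ⟨⟨Y, hY, rfl⟩, ⟨y, hy, hyx⟩⟩
      have := block_eq hY hy
      subst this
      exact Set.Subset.antisymm (hsub _ _ hyx.symm) (hsub _ _ hyx)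
  -- Pull-back of functions along `π`. It is multiplicative up to the factor `|ker π|`, which is
  -- cancelled over `ℤ`, so closure under products can be tested in `A`.
  let P : AddMonoidAlgebra ℤ G' → AddMonoidAlgebra ℤ G := fun f =>
    AddMonoidAlgebra.ofCoeff (Finsupp.equivFunOnFinite.symm fun x => f.coeff (π x))
  have hPc : ∀ f x, (P f).coeff x = f.coeff (π x) := fun f x => rfl
  have hP : ∀ f, f ∈ AddSubgroup.closure (xi '' ((fun X : Set G => π '' X) '' A.basicSets)) ↔
      P f ∈ A.toSubring := by
    intro f
    rw [mem_closure_xi_iff hpart, A.mem_iff]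
    constructor
    · intro h X hX x hx y hy
      exact h _ ⟨X, hX, rfl⟩ _ ⟨x, hx, rfl⟩ _ ⟨y, hy, rfl⟩
    · rintro h _ ⟨X, hX, rfl⟩ _ ⟨x, hx, rfl⟩ _ ⟨y, hy, rfl⟩
      exact h X hX x hx y hy
  have hmul : ∀ f g x, (P f * P g).coeff x = Nat.card π.ker * (P (f * g)).coeff x := by
    classical
    intro f g x
    have := Fintype.ofFinite G
    have := Fintype.ofFinite G'
    rw [hPc, coeff_mul_eq_sum, coeff_mul_eq_sum, ← Finset.sum_fiberwise _ π, Finset.mul_sum]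
    refine Finset.sum_congr rfl fun z _ => ?_
    have hc : ({y | π y = z} : Finset G).card = Nat.card π.ker := by
      rw [AddMonoidHom.card_fiber_eq_of_mem_range π (hπ z) (hπ 0), ← Fintype.card_subtype,
        ← Nat.card_eq_fintype_card]
      rfl
    rw [← hc, ← nsmul_eq_mul, ← Finset.sum_const]
    refine Finset.sum_congr rfl fun y hy => ?_
    rw [hPc, hPc, map_sub, (Finset.mem_filter.1 hy).2]
  { carrier := AddSubgroup.closure (xi '' ((fun X : Set G => π '' X) '' A.basicSets))
    zero_mem' := AddSubgroup.zero_mem _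
    add_mem' := AddSubgroup.add_mem _
    neg_mem' := AddSubgroup.neg_mem _
    one_mem' := by
      have h : P 1 = xi (π.ker : Set G) := by
        classical
        ext x
        simp [hPc, coeff_xi, AddMonoidAlgebra.one_def, Finsupp.single_apply, AddMonoidHom.mem_ker,
          eq_comm]
      exact (hP 1).2 (h ▸ hker.xi_mem)
    mul_mem' := by
      intro f g hf hg
      refine (hP _).2 ((A.mem_iff _).2 fun X hX x hx y hy => ?_)
      have h := (A.mem_iff _).1 (A.toSubring.mul_mem ((hP f).1 hf) ((hP g).1 hg)) X hX x hx y hy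
      rw [hmul, hmul] at h
      exact mul_left_cancel₀ (by exact_mod_cast Nat.card_pos.ne') h
    basicSets := (fun X : Set G => π '' X) '' A.basicSets
    isPartition := hpart
    zero_basic := ⟨{0}, A.zero_basic, by simp⟩
    neg_basic := by
      rintro _ ⟨X, hX, rfl⟩
      exact ⟨-X, A.neg_basic X hX, Set.image_neg_of_apply_neg_eq_neg (fun x _ => map_neg π x)⟩
    span_basic := rfl }

end SchurRing

/-! ### Torsion, idempotents and units in finite rings -/

section FiniteRing

variable {R : Type*} [CommRing R]

theorem mem_componentIdeal_compl_singleton {p : ℕ} (hp : p.Prime) {x : R} :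
    x ∈ componentIdeal R {p}ᶜ ↔ ¬ p ∣ addOrderOf x := by
  change (∀ q : ℕ, q.Prime → q ∣ addOrderOf x → q ≠ p) ↔ _
  exact ⟨fun h hd => h p hp hd rfl, fun h q _ hd hqp => h (hqp ▸ hd)⟩

theorem mem_componentIdeal_compl_singleton_of_nsmul {p : ℕ} (hp : p.Prime) {x : R} {k : ℕ}
    (hk : ¬ p ∣ k) (hx : k • x = 0) : x ∈ componentIdeal R {p}ᶜ :=
  (mem_componentIdeal_compl_singleton hp).2 fun h =>
    hk (h.trans (addOrderOf_dvd_of_nsmul_eq_zero hx))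

theorem eq_zero_of_mem_componentIdeal_compl {p : ℕ} (hp : p.Prime) {x : R}
    (hx : x ∈ componentIdeal R {p}ᶜ) (hpx : (p : R) * x = 0) : x = 0 := by
  rw [mem_componentIdeal_compl_singleton hp] at hx
  rw [← nsmul_eq_mul] at hpx
  rcases (Nat.dvd_prime hp).1 (addOrderOf_dvd_of_nsmul_eq_zero hpx) with h | h
  · exact AddMonoid.addOrderOf_eq_one_iff.1 h
  · exact absurd h.symm.dvd hx

/-- Turns subgroups invariant under units, which is all that an S-ring over a ring supplies, into
ideals. -/
theorem mul_mem_of_closure_units (h1 : AddSubgroup.closure {r : R | IsUnit r} = ⊤)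
    (M : AddSubgroup R) (hM : ∀ u : Rˣ, ∀ m ∈ M, (u : R) * m ∈ M) (r : R) {m : R} (hm : m ∈ M) :
    r * m ∈ M := by
  have hr : r ∈ AddSubgroup.closure {r : R | IsUnit r} := h1 ▸ AddSubgroup.mem_top r
  induction hr using AddSubgroup.closure_induction with
  | mem r hr =>
    obtain ⟨u, rfl⟩ := hr
    exact hM u m hm
  | zero => simp
  | add a b _ _ ha hb => rw [add_mul]; exact add_mem ha hb
  | neg a _ ha => rw [neg_mul]; exact neg_mem ha

variable [Finite R]

/-- A non-zero element of finite order has a multiple of prime order. -/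
theorem exists_nsmul_prime {x : R} (hx : x ≠ 0) :
    ∃ p k : ℕ, p.Prime ∧ p ∣ addOrderOf x ∧ k • x ≠ 0 ∧ (p : R) * (k • x) = 0 := by
  obtain ⟨p, hp, k, hk⟩ := Nat.exists_prime_and_dvd (mt AddMonoid.addOrderOf_eq_one_iff.1 hx)
  have hpos : 0 < p * k := hk ▸ addOrderOf_pos x
  refine ⟨p, k, hp, ⟨k, hk⟩, fun h => ?_, ?_⟩
  · have h1 := Nat.le_of_dvd (Nat.pos_of_mul_pos_left hpos)
      (addOrderOf_dvd_of_nsmul_eq_zero h)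
    rw [hk] at h1
    nlinarith [hp.two_le, Nat.pos_of_mul_pos_left hpos]
  · rw [← nsmul_eq_mul, smul_smul, ← hk, addOrderOf_nsmul_eq_zero]

theorem eq_zero_of_forall_prime {Q : Set ℕ} {I : Ideal R}
    (h : ∀ p ∈ Q, ∀ e ∈ I, (p : R) * e = 0 → e = 0) {x : R} (hx : x ∈ I)
    (hQ : x ∈ componentIdeal R Q) : x = 0 := by
  by_contra hne
  obtain ⟨p, k, hp, hd, hk, hpk⟩ := exists_nsmul_prime hne
  exact hk (h p (hQ p hp hd) _ (nsmul_mem hx k) hpk)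

theorem exists_pow_isIdempotentElem (a : R) : ∃ n ≠ 0, IsIdempotentElem (a ^ n) := by
  obtain ⟨m, n, hmn, h⟩ := Finite.exists_ne_map_eq_of_infinite (fun n : ℕ => a ^ n)
  wlog hlt : m < n generalizing m n
  · exact this n m hmn.symm h.symm (by omega)
  obtain ⟨d, rfl⟩ := Nat.exists_eq_add_of_lt hlt
  set c := d + 1 with hc
  have hstep : ∀ k, m ≤ k → a ^ (k + c) = a ^ k := by
    intro k hk
    obtain ⟨j, rfl⟩ := Nat.exists_eq_add_of_le hk
    have h' : a ^ m = a ^ (m + c) := h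
    rw [show m + j + c = (m + c) + j by ring, pow_add, ← h', ← pow_add]
  have hmul : ∀ t k, m ≤ k → a ^ (k + t * c) = a ^ k := by
    intro t
    induction t with
    | zero => simp
    | succ t ih =>
      intro k hk
      rw [show k + (t + 1) * c = (k + t * c) + c by ring, hstep _ (by omega), ih k hk]
  -- Powers of `a` have period `c` from `m` on; the exponent must be a multiple of `c` and at least
  -- `m`.
  refine ⟨(m + 1) * c, by positivity, ?_⟩
  have hle : m ≤ (m + 1) * c := by nlinarith
  change a ^ ((m + 1) * c) * a ^ ((m + 1) * c) = a ^ ((m + 1) * c)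
  rw [← pow_add]
  exact hmul (m + 1) _ hle

/-- In a finite ring, an element agrees with a unit wherever some idempotent power of it acts
trivially. -/
theorem exists_unit_of_pow (a : R) :
    ∃ (n : ℕ) (u : Rˣ), n ≠ 0 ∧ IsIdempotentElem (a ^ n) ∧ (u : R) = a * a ^ n + (1 - a ^ n) := by
  obtain ⟨n, hn, hid⟩ := exists_pow_isIdempotentElem a
  obtain ⟨k, rfl⟩ := Nat.exists_eq_succ_of_ne_zero hn
  have hid' : a ^ (k + 1) * a ^ (k + 1) = a ^ (k + 1) := hid
  -- On the part cut out by the idempotent `a ^ (k + 1)` the inverse of `a` is `a ^ k`; both factors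
  -- are 1 on the other part.
  have hu : (a * a ^ (k + 1) + (1 - a ^ (k + 1))) *
      (a ^ k * a ^ (k + 1) + (1 - a ^ (k + 1))) = 1 := by
    have h1 : a * a ^ k = a ^ (k + 1) := by ring
    linear_combination (a ^ (k + 1) * a ^ (k + 1)) * h1 +
      (a ^ (k + 1) - a - a ^ k + 2) * hid'
  exact ⟨k + 1, Units.mkOfMulEqOne _ _ hu, by omega, hid, rfl⟩

/-- Since `a` is injective on `I`, its idempotent power acts on `I` as the identity, so the unit of
`exists_unit_of_pow` acts there as `a`. -/
theorem exists_unit_mul_eq {a : R} {I : Ideal R} (h : ∀ y ∈ I, a * y = 0 → y = 0) :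
    ∃ u : Rˣ, ∀ y ∈ I, (u : R) * y = a * y := by
  obtain ⟨n, u, -, hid, hu⟩ := exists_unit_of_pow a
  refine ⟨u, fun y hy => ?_⟩
  have hpow : ∀ k : ℕ, ∀ y ∈ I, a ^ k * y = 0 → y = 0 := by
    intro k
    induction k with
    | zero => simp
    | succ k ih =>
      intro y hy hk
      exact h y hy (ih _ (I.mul_mem_left _ hy) (by rw [← hk]; ring))
  have h1 : a ^ n * y - y = 0 := by
    refine hpow n _ (sub_mem (I.mul_mem_left _ hy) hy) ?_
    have hid' : a ^ n * a ^ n = a ^ n := hid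
    linear_combination y * hid'
  rw [hu]
  linear_combination (a - 1) * h1

/-- Units lift along surjections of finite rings. -/
theorem exists_unit_map_eq {S : Type*} [CommRing S] (f : R →+* S) (hf : Function.Surjective f)
    (v : Sˣ) : ∃ u : Rˣ, f u = v := by
  obtain ⟨a, ha⟩ := hf v
  obtain ⟨n, u, -, hid, hu⟩ := exists_unit_of_pow a
  refine ⟨u, ?_⟩
  -- An idempotent unit is 1, so the correction term `1 - a ^ n` dies under `f`.
  have h1 : (v : S) ^ n = 1 := by
    have h2 : (v : S) ^ n * (v : S) ^ n = (v : S) ^ n := by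
      rw [← ha, ← map_pow, ← map_mul, hid]
    have h3 : v ^ n * v ^ n = v ^ n := Units.ext (by simpa using h2)
    have h4 : v ^ n = 1 := by simpa using h3
    simpa using congrArg Units.val h4
  rw [hu]
  simp [ha, h1]

theorem componentOne_mul_self (Q : Set ℕ) :
    componentOne R Q * componentOne R Q = componentOne R Q :=
  componentOne_mul R Q (componentOne_mem R Q)

/-- If the order were `p * m` with `p ∈ Q`, the `m`-fold multiple would lie in `R_Q`; but `1_Q`
annihilates it, so it would vanish. -/
theorem one_sub_componentOne_mem (Q : Set ℕ) : 1 - componentOne R Q ∈ componentIdeal R Qᶜ := by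
  intro p hp hd hpQ
  obtain ⟨m, hm⟩ := hd
  have hx : (m : R) * (1 - componentOne R Q) ∈ componentIdeal R Q := by
    intro q hq hqd
    have h1 : p • ((m : R) * (1 - componentOne R Q)) = 0 := by
      rw [← nsmul_eq_mul, smul_smul, ← hm, addOrderOf_nsmul_eq_zero]
    have h2 := hqd.trans (addOrderOf_dvd_of_nsmul_eq_zero h1)
    rwa [(Nat.prime_dvd_prime_iff_eq hq hp).1 h2]
  have h0 : (m : R) * (1 - componentOne R Q) = 0 := by
    rw [← componentOne_mul R Q hx]
    linear_combination (-(m : R)) * componentOne_mul_self (R := R) Q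
  rw [← nsmul_eq_mul] at h0
  have hpos : 0 < p * m := hm ▸ addOrderOf_pos _
  have h3 := Nat.le_of_dvd (Nat.pos_of_mul_pos_left hpos)
    (addOrderOf_dvd_of_nsmul_eq_zero h0)
  rw [hm] at h3
  nlinarith [hp.two_le, Nat.pos_of_mul_pos_left hpos]

end FiniteRing

/-! ### Ideals produced by an S-ring over a ring -/

namespace SchurRing

variable {R : Type*} [CommRing R] [Finite R] {A : SchurRing R}

theorem IsOverRing.smul (hA : A.IsOverRing) {X : Set R} (hX : A.IsASet X) (u : Rˣ) :
    A.IsASet (u • X) := by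
  refine isASet_of_forall_exists fun x hx => ?_
  obtain ⟨y, hy, rfl⟩ := hx
  exact ⟨u • A.block y, isASet_of_mem (hA u _ (A.block_mem y)),
    Set.smul_mem_smul_set (A.mem_block y), Set.smul_set_mono (isASet_iff_block.1 hX y hy)⟩

theorem IsOverRing.mul_mem_block (hA : A.IsOverRing) (u : Rˣ) {x y : R} (h : y ∈ A.block x) :
    (u : R) * y ∈ A.block (u * x) := by
  have h1 : A.block ((u : R) * x) = u • A.block x :=
    block_eq (hA u _ (A.block_mem x)) (Set.smul_mem_smul_set (A.mem_block x))
  rw [h1]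
  exact Set.smul_mem_smul_set h

/-- Sums, negatives and unit multiples of `A`-sets are `A`-sets, and these operations generate the
span because units generate `R` additively. -/
theorem isAIdeal_span (hA : A.IsOverRing) (h1 : AddSubgroup.closure {r : R | IsUnit r} = ⊤)
    {Z : Set R} (hZ : A.IsASet Z) : A.IsAIdeal (Ideal.span Z) := by
  refine isASet_of_forall_exists fun x hx => ?_
  have hx' : x ∈ Ideal.span Z := hx
  clear hx
  induction hx' using Submodule.span_induction with
  | mem x hx => exact ⟨Z, hZ, hx, Ideal.subset_span⟩
  | zero => exact ⟨{0}, isASet_of_mem A.zero_basic, rfl, by simp⟩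
  | add x y _ _ hx hy =>
    obtain ⟨V, hV, hxV, hVs⟩ := hx
    obtain ⟨W, hW, hyW, hWs⟩ := hy
    refine ⟨V + W, hV.add hW, Set.add_mem_add hxV hyW, ?_⟩
    rintro _ ⟨v, hv, w, hw, rfl⟩
    exact add_mem (hVs hv) (hWs hw)
  | smul r x _ hx =>
    obtain ⟨V, hV, hxV, hVs⟩ := hx
    have hr : r ∈ AddSubgroup.closure {r : R | IsUnit r} := h1 ▸ AddSubgroup.mem_top r
    induction hr using AddSubgroup.closure_induction with
    | mem r hr =>
      obtain ⟨u, rfl⟩ := hr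
      refine ⟨u • V, hA.smul hV u, Set.smul_mem_smul_set hxV, ?_⟩
      rintro _ ⟨v, hv, rfl⟩
      exact Ideal.mul_mem_left _ _ (hVs hv)
    | zero => exact ⟨{0}, isASet_of_mem A.zero_basic, by simp, by simp⟩
    | add a b _ _ ha hb =>
      obtain ⟨V₁, hV₁, ha, hs₁⟩ := ha
      obtain ⟨V₂, hV₂, hb, hs₂⟩ := hb
      refine ⟨V₁ + V₂, hV₁.add hV₂, ?_, ?_⟩
      · rw [add_smul]
        exact Set.add_mem_add ha hb
      · rintro _ ⟨v, hv, w, hw, rfl⟩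
        exact add_mem (hs₁ hv) (hs₂ hw)
    | neg a _ ha =>
      obtain ⟨V₁, hV₁, ha, hs₁⟩ := ha
      refine ⟨-V₁, hV₁.neg, by simpa using ha, fun v hv => ?_⟩
      exact neg_mem_iff.1 (hs₁ hv)

theorem IsAIdeal.sup {K I : Ideal R} (hK : A.IsAIdeal K) (hI : A.IsAIdeal I) :
    A.IsAIdeal (K ⊔ I) := by
  unfold IsAIdeal
  rw [Submodule.coe_sup]
  exact IsASet.add hK hI

theorem IsMaximalAIdeal.sup_eq_top {K I : Ideal R} (hI : A.IsMaximalAIdeal I) (hK : A.IsAIdeal K)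
    (hKI : ¬ K ≤ I) : K ⊔ I = ⊤ := by
  by_contra hne
  exact hKI (le_sup_left.trans (hI.le_of_ge ⟨hK.sup hI.prop.1, hne⟩ le_sup_right))

/-- The translations that fix all basic sets meeting a unit-invariant `A`-set form an `A`-ideal. -/
theorem exists_ideal_of_translations (hA : A.IsOverRing)
    (h1 : AddSubgroup.closure {r : R | IsUnit r} = ⊤) (B : Set R)
    (hu : ∀ u : Rˣ, ∀ z ∈ B, (u : R) * z ∈ B) :
    ∃ K : Ideal R, A.IsAIdeal K ∧ ∀ m, m ∈ K ↔ ∀ z ∈ B, ∀ w ∈ A.block z, w + m ∈ A.block z := by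
  let M : AddSubgroup R := ⨅ z : B, AddAction.stabilizer R (A.block z)
  have hM : ∀ m, m ∈ M ↔ ∀ z ∈ B, ∀ w ∈ A.block z, w + m ∈ A.block z := by
    intro m
    simp only [M, AddSubgroup.mem_iInf, AddAction.mem_stabilizer_iff, Subtype.forall]
    refine forall₂_congr fun z hz => ⟨fun h w hw => ?_, fun h => ?_⟩
    · rw [← h, add_comm]
      exact Set.vadd_mem_vadd_set hw
    · refine Set.eq_of_subset_of_ncard_le ?_ (by simp [Set.ncard_vadd_set])
      rintro _ ⟨w, hw, rfl⟩
      have := h w hw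
      rwa [add_comm] at this
  have hMu : ∀ u : Rˣ, ∀ m ∈ M, (u : R) * m ∈ M := by
    intro u m hm
    rw [hM] at hm ⊢
    intro z hz w hw
    -- Translating by `u * m` at `w` is translating by `m` at `u⁻¹ * w`, seen after multiplication
    -- by `u`.
    have h2 := hm _ (hu u⁻¹ z hz) _ (hA.mul_mem_block u⁻¹ hw)
    have h3 := hA.mul_mem_block u h2
    simpa [mul_add] using h3
  refine ⟨{ M with smul_mem' := fun r m hm => mul_mem_of_closure_units h1 M hMu r hm }, ?_, hM⟩
  refine isASet_iff_block.2 fun x hx => ?_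
  intro y hy
  change y ∈ M
  have hx' : x ∈ M := hx
  simp only [M, AddSubgroup.mem_iInf] at hx' ⊢
  exact fun z => (isASet_block (z : R)).stabilizer.subset (A.block_mem x) (A.mem_block x) (hx' z) hy

end SchurRing

/-! ### Torsion-saturated S-rings: counting in cosets of the `p`-torsion -/

namespace SchurRing

variable {R : Type*} [CommRing R] [Finite R]

/-- An S-ring over a ring with a maximal `A`-ideal `I`, such that the basic sets outside `I` are
invariant, as far as possible, under translations by the elements of prime order `p ∈ Q`.
These properties are inherited by quotients. -/
structure IsTorsionSaturated (A : SchurRing R) (I : Ideal R) (Q : Set ℕ) : Prop where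
  closure_units : AddSubgroup.closure {r : R | IsUnit r} = ⊤
  isOverRing : A.IsOverRing
  isMaximal : A.IsMaximalAIdeal I
  primes_eq : Q = ↑(Nat.card (R ⧸ I)).primeFactors
  saturated : ∀ p ∈ Q, ∀ x e : R, x ∉ I → (p : R) * e = 0 → x ∉ componentIdeal R {p}ᶜ →
    x + e ∉ componentIdeal R {p}ᶜ → x + e ∈ A.block x

instance finite_quotient (I : Ideal R) : Finite (R ⧸ I) :=
  Finite.of_surjective _ Ideal.Quotient.mk_surjective

namespace IsTorsionSaturated

variable {A : SchurRing R} {I : Ideal R} {Q : Set ℕ} (h : A.IsTorsionSaturated I Q)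
include h

theorem isAIdeal : A.IsAIdeal I := h.isMaximal.prop.1

theorem notMem_of_mem_block {x y : R} (hx : x ∉ I) (hy : y ∈ A.block x) : y ∉ I := fun hyI =>
  hx (IsASet.subset h.isAIdeal (A.block_mem x) hy hyI (A.mem_block x))

theorem prime {p : ℕ} (hp : p ∈ Q) : p.Prime := by
  rw [h.primes_eq] at hp
  exact Nat.prime_of_mem_primeFactors hp

theorem dvd_card {p : ℕ} (hp : p ∈ Q) : p ∣ Nat.card (R ⧸ I) := by
  rw [h.primes_eq] at hp
  exact Nat.dvd_of_mem_primeFactors hp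

theorem exists_torsion {p : ℕ} (hp : p ∈ Q) : ∃ e : R, e ≠ 0 ∧ (p : R) * e = 0 := by
  have : Fact p.Prime := ⟨h.prime hp⟩
  have hd : p ∣ Nat.card R :=
    (h.dvd_card hp).trans (AddSubgroup.card_quotient_dvd_card I.toAddSubgroup)
  obtain ⟨e, he⟩ := exists_prime_addOrderOf_dvd_card' p hd
  refine ⟨e, ?_, ?_⟩
  · rintro rfl
    rw [addOrderOf_zero] at he
    exact (h.prime hp).ne_one he.symm
  · rw [← nsmul_eq_mul, ← he, addOrderOf_nsmul_eq_zero]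

theorem exists_mem : ∃ p, p ∈ Q := by
  have hne : Nat.card (R ⧸ I) ≠ 1 := by
    intro h1
    have := (Nat.card_eq_one_iff_unique.1 h1).1
    exact h.isMaximal.prop.2 (Ideal.Quotient.subsingleton_iff.1 this)
  obtain ⟨p, hp, hd⟩ := Nat.exists_prime_and_dvd hne
  exact ⟨p, by
    rw [h.primes_eq]
    exact Nat.mem_primeFactors.2 ⟨hp, hd, Nat.card_pos.ne'⟩⟩

/-- The set is a coset of the `p`-torsion subgroup, which contains an element of order `p`. -/
theorem dvd_card_torsion {p : ℕ} (hp : p ∈ Q) (x : R) : p ∣ ({w | p • w = p • x} : Set R).ncard := by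
  have : Fact p.Prime := ⟨h.prime hp⟩
  let E : AddSubgroup R := (Submodule.torsionBy R R (p : R)).toAddSubgroup
  have hE : ∀ e, e ∈ E ↔ (p : R) * e = 0 := fun e => Submodule.mem_torsionBy_iff _ _
  have himg : ({w | p • w = p • x} : Set R) = (fun e => x + e) '' (E : Set R) := by
    ext w
    constructor
    · intro hw
      have hw' : p • w = p • x := hw
      rw [nsmul_eq_mul, nsmul_eq_mul] at hw'
      exact ⟨w - x, (hE _).2 (by linear_combination hw'), by ring⟩
    · rintro ⟨e, he, rfl⟩
      have := (hE e).1 he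
      change p • (x + e) = p • x
      rw [nsmul_eq_mul, nsmul_eq_mul]
      linear_combination this
  rw [himg, Set.ncard_image_of_injective _ (add_right_injective x)]
  obtain ⟨e, he0, he⟩ := h.exists_torsion hp
  have hord : addOrderOf (⟨e, (hE e).2 he⟩ : E) = p := by
    refine addOrderOf_eq_prime ?_ ?_
    · exact Subtype.ext (by simpa [nsmul_eq_mul] using he)
    · intro h0
      exact he0 (congrArg Subtype.val h0)
  have h2 := addOrderOf_dvd_natCard (⟨e, (hE e).2 he⟩ : E)
  rw [hord] at h2
  exact h2

/-- An `A`-set of elements of order prime to `p ∈ Q` lies in `I`. -/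
theorem mem_of_subset_componentIdeal {p : ℕ} (hp : p ∈ Q) {W : Set R} (hW : A.IsASet W)
    (hWp : W ⊆ componentIdeal R {p}ᶜ) : W ⊆ I := by
  have hpp := h.prime hp
  have : Fact p.Prime := ⟨hpp⟩
  by_contra hWI
  have hspan : Ideal.span W ≤ componentIdeal R {p}ᶜ := Ideal.span_le.2 hWp
  have htop := h.isMaximal.sup_eq_top (isAIdeal_span h.isOverRing h.closure_units hW)
    (fun hle => hWI (Ideal.subset_span.trans hle))
  -- Writing `1 = n + i`, the order of `n` is prime to `p` and annihilates `R ⧸ I`, contrary to `p ∣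
  -- |R ⧸ I|`.
  obtain ⟨n, hn, i, hi, hni⟩ := Submodule.mem_sup.1 (htop ▸ Submodule.mem_top : (1 : R) ∈ _)
  have hn' := (mem_componentIdeal_compl_singleton hpp).1 (hspan hn)
  obtain ⟨x, hx⟩ := exists_prime_addOrderOf_dvd_card' p (h.dvd_card hp)
  obtain ⟨r, rfl⟩ := Ideal.Quotient.mk_surjective x
  refine hn' (hx ▸ addOrderOf_dvd_of_nsmul_eq_zero ?_)
  rw [← map_nsmul, Ideal.Quotient.eq_zero_iff_mem]
  have h0 : addOrderOf n • n = 0 := addOrderOf_nsmul_eq_zero n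
  rw [nsmul_eq_mul] at h0
  have : addOrderOf n • r = ((addOrderOf n : R) * r) * i := by
    rw [nsmul_eq_mul]
    linear_combination (-(addOrderOf n : R) * r) * hni + r * h0
  rw [this]
  exact I.mul_mem_left _ hi

/-- If `p` divides the number of `w` in a basic set outside `I` with `p • w = p • x`, then all `w`
with `p • w = p • x` belong to it. -/
theorem add_mem_of_dvd {p : ℕ} (hp : p ∈ Q) {x : R} (hx : x ∉ I)
    (hd : p ∣ ({w | w ∈ A.block x ∧ p • w = p • x} : Set R).ncard) {e : R} (he : (p : R) * e = 0) :
    x + e ∈ A.block x := by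
  have hpp := h.prime hp
  by_contra hn
  have hdiff : ∀ {v w : R}, p • v = p • x → p • w = p • x → (p : R) * (v - w) = 0 := by
    intro v w hv hw
    rw [nsmul_eq_mul] at hv hw
    linear_combination hv - hw
  have hy : p • (x + e) = p • x := by
    rw [nsmul_eq_mul, nsmul_eq_mul]
    linear_combination he
  -- The coset has at most one point of order prime to `p`; by `hP` the block of `x` contains all or
  -- none of the remaining points.
  have huniq : ∀ {v w : R}, p • v = p • x → p • w = p • x → v ∈ componentIdeal R {p}ᶜ →
      w ∈ componentIdeal R {p}ᶜ → v = w := by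
    intro v w hv hw hv' hw'
    exact sub_eq_zero.1 (eq_zero_of_mem_componentIdeal_compl hpp (sub_mem hv' hw') (hdiff hv hw))
  have hP : ∀ {v w : R}, v ∈ A.block x → p • v = p • x → p • w = p • x →
      v ∉ componentIdeal R {p}ᶜ → w ∉ componentIdeal R {p}ᶜ → w ∈ A.block x := by
    intro v w hvx hv hw hv' hw'
    have := h.saturated p hp v (w - v) (h.notMem_of_mem_block hx hvx) (hdiff hw hv) hv'
      (by simpa using hw')
    rwa [add_sub_cancel, block_eq_of_mem hvx] at this
  by_cases hxc : x ∈ componentIdeal R {p}ᶜ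
  · have hyc : x + e ∉ componentIdeal R {p}ᶜ := fun hyc =>
      hn (huniq rfl hy hxc hyc ▸ A.mem_block x)
    -- Here `x` is the exceptional point, and the count would be 1.
    have hC : ({w | w ∈ A.block x ∧ p • w = p • x} : Set R) = {x} := by
      refine Set.Subset.antisymm (fun w hw => ?_) ?_
      · by_cases hwc : w ∈ componentIdeal R {p}ᶜ
        · exact huniq hw.2 rfl hwc hxc
        · exact absurd (hP hw.1 hw.2 hy hwc hyc) hn
      · rintro _ rfl
        exact ⟨A.mem_block _, rfl⟩
    rw [hC, Set.ncard_singleton] at hd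
    exact hpp.ne_one (Nat.dvd_one.1 hd)
  · have hyc : x + e ∈ componentIdeal R {p}ᶜ := by
      by_contra hyc
      exact hn (hP (A.mem_block x) rfl hy hxc hyc)
    -- Here `x + e` is the exceptional point and the only one missing, so the count would be one
    -- less than a multiple of `p`.
    have hC : insert (x + e) ({w | w ∈ A.block x ∧ p • w = p • x} : Set R) =
        {w | p • w = p • x} := by
      refine Set.Subset.antisymm ?_ fun w hw => ?_
      · rintro w (rfl | hw)
        exacts [hy, hw.2]
      · by_cases hwc : w ∈ componentIdeal R {p}ᶜ
        · exact Or.inl (huniq hw hy hwc hyc)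
        · exact Or.inr ⟨hP (A.mem_block x) rfl hw hxc hwc, hw⟩
    have hcard := Set.ncard_insert_of_notMem
      (s := ({w | w ∈ A.block x ∧ p • w = p • x} : Set R)) (fun hw => hn hw.1)
    have hD := h.dvd_card_torsion hp x
    rw [← hC, hcard] at hD
    exact hpp.ne_one (Nat.dvd_one.1 ((Nat.dvd_add_right hd).1 hD))

/-- If `g` has order divisible by `p`, no `w` with `p • w = g` is exceptional, so the block contains
all or none of them and the count is divisible by `p`. Thus the `A`-set of `IsASet.primePower`
consists of elements of order prime to `p` and falls into `I`. -/
theorem nsmul_mem_of_not_dvd {p : ℕ} (hp : p ∈ Q) {x : R} (hx : x ∉ I)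
    (hd : ¬ p ∣ ({w | w ∈ A.block x ∧ p • w = p • x} : Set R).ncard) :
    p • x ∈ componentIdeal R {p}ᶜ ∧ p • x ∈ I := by
  have hW := (isASet_block (A := A) x).primePower (h.prime hp)
  have hsub : {g | ¬ p ∣ ({w | w ∈ A.block x ∧ p • w = g} : Set R).ncard} ⊆
      (componentIdeal R {p}ᶜ : Set R) := by
    intro g hg
    by_contra hgc
    obtain ⟨w, hw, rfl⟩ : ({w | w ∈ A.block x ∧ p • w = g} : Set R).Nonempty := by
      by_contra hne
      rw [Set.not_nonempty_iff_eq_empty] at hne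
      apply hg
      rw [hne]
      simp
    apply hg
    have hall : ({v | v ∈ A.block x ∧ p • v = p • w} : Set R) = {v | p • v = p • w} := by
      refine Set.Subset.antisymm (fun v hv => hv.2) fun v hv => ⟨?_, hv⟩
      have hmem : ∀ z, p • z = p • w → z ∉ componentIdeal R {p}ᶜ := by
        intro z hz hzc
        apply hgc
        rw [← hz]
        exact nsmul_mem hzc p
      have hv' : p • v = p • w := hv
      have := h.saturated p hp w (v - w) (h.notMem_of_mem_block hx hw)
        (by rw [nsmul_eq_mul, nsmul_eq_mul] at hv'; linear_combination hv') (hmem w rfl)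
        (by rw [add_sub_cancel]; exact hmem v hv')
      rwa [add_sub_cancel, block_eq_of_mem hw] at this
    rw [hall]
    exact h.dvd_card_torsion hp w
  exact ⟨hsub hd, h.mem_of_subset_componentIdeal hp hW hsub hd⟩

/-- As `p • x` has order `k` prime to `p`, Bézout splits `x` into a `p`-torsion part and a multiple
`y` of `p • x`, which lies in `I`. Adding non-zero torsion to `y` never gives the exceptional point,
so saturation links all these sums to `x`. -/
theorem exists_split {p : ℕ} (hp : p ∈ Q) {x : R} (hx : x ∉ I)
    (hd : ¬ p ∣ ({w | w ∈ A.block x ∧ p • w = p • x} : Set R).ncard) :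
    ∃ e y, (p : R) * e = 0 ∧ y ∈ I ∧ x = e + y ∧
      ∀ f, (p : R) * f = 0 → f ≠ 0 → f + y ∈ A.block x := by
  have hpp := h.prime hp
  obtain ⟨hpc, hpI⟩ := h.nsmul_mem_of_not_dvd hp hx hd
  have hcop := (mem_componentIdeal_compl_singleton hpp).1 hpc
  set k := addOrderOf (p • x) with hk
  have hk0 : k • p • x = 0 := addOrderOf_nsmul_eq_zero _
  obtain ⟨a, b, hab⟩ := (Nat.isCoprime_iff_coprime.2 ((hpp.coprime_iff_not_dvd.2 hcop).symm) :
    IsCoprime (k : ℤ) (p : ℤ))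
  have hab' : (a : R) * k + (b : R) * p = 1 := by exact_mod_cast congrArg (Int.cast : ℤ → R) hab
  have he : (p : R) * ((a : R) * k * x) = 0 := by
    rw [nsmul_eq_mul, nsmul_eq_mul] at hk0
    linear_combination (a : R) * hk0
  have hyI : (b : R) * (p • x) ∈ I := I.mul_mem_left _ hpI
  have hyc : (b : R) * (p • x) ∈ componentIdeal R {p}ᶜ := Ideal.mul_mem_left _ _ hpc
  have hxe : x = (a : R) * k * x + (b : R) * (p • x) := by
    rw [nsmul_eq_mul]
    linear_combination (-x) * hab'
  have hnc : ∀ f, (p : R) * f = 0 → f ≠ 0 → f + (b : R) * (p • x) ∉ componentIdeal R {p}ᶜ := by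
    intro f hf hf0 hfc
    exact hf0 (eq_zero_of_mem_componentIdeal_compl hpp ((add_mem_cancel_right hyc).1 hfc) hf)
  have he0 : (a : R) * k * x ≠ 0 := by
    intro h0
    rw [h0, zero_add] at hxe
    exact hx (hxe ▸ hyI)
  refine ⟨_, _, he, hyI, hxe, fun f hf hf0 => ?_⟩
  have hsum : x + (f - (a : R) * k * x) = f + (b : R) * (p • x) := by
    linear_combination hxe
  have := h.saturated p hp x (f - (a : R) * k * x) hx (by rw [mul_sub, hf, he, sub_zero])
    (by have := hnc _ he he0; rwa [← hxe] at this) (by rw [hsum]; exact hnc f hf hf0)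
  rwa [hsum] at this

/-- If `I` contains an element of order `p ∈ Q`, then the basic sets outside `I` are invariant under
translation by all elements of order `p`. -/
theorem add_mem_of_torsion_mem {p : ℕ} (hp : p ∈ Q) {f : R} (hfI : f ∈ I) (hf : (p : R) * f = 0)
    (hf0 : f ≠ 0) {x : R} (hx : x ∉ I) {e : R} (he : (p : R) * e = 0) : x + e ∈ A.block x := by
  by_cases hd : p ∣ ({w | w ∈ A.block x ∧ p • w = p • x} : Set R).ncard
  · exact h.add_mem_of_dvd hp hx hd he
  · obtain ⟨_, y, -, hy, -, hall⟩ := h.exists_split hp hx hd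
    exact absurd (add_mem hfI hy) (h.notMem_of_mem_block hx (hall f hf hf0))

/-- The ideal of all translations that fix the basic sets outside `I`. -/
theorem exists_translationIdeal :
    ∃ K : Ideal R, A.IsAIdeal K ∧ ∀ m, m ∈ K ↔ ∀ x ∉ I, x + m ∈ A.block x := by
  obtain ⟨K, hK, hm⟩ := exists_ideal_of_translations h.isOverRing h.closure_units (I : Set R)ᶜ
    (fun u z hz hzI => hz (by simpa using I.mul_mem_left (u⁻¹ : Rˣ) hzI))
  refine ⟨K, hK, fun m => (hm m).trans ⟨fun h' x hx => h' x hx x (A.mem_block x), ?_⟩⟩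
  intro h' z hz w hw
  rw [← block_eq_of_mem hw]
  exact h' w (h.notMem_of_mem_block hz hw)

/-- A translation `m ∉ I` would carry `-m` into place: `m + (-m) = 0` would lie in the block of `m`.
-/
theorem le_of_translations {K : Ideal R} (hK : ∀ m ∈ K, ∀ x ∉ I, x + m ∈ A.block x) : K ≤ I := by
  intro m hm
  by_contra hmI
  have := hK (-m) (neg_mem hm) m hmI
  rw [add_neg_cancel] at this
  exact h.notMem_of_mem_block hmI this I.zero_mem

/-! ### Fibres of outer basic sets when `I` has no `p`-torsion for `p ∈ Q` -/

section Disjoint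

variable (hI : ∀ p ∈ Q, ∀ f ∈ I, (p : R) * f = 0 → f = 0)
include hI

/-- Every basic set outside `I` meets the coset `s + I`, for `s` of prime order `p ∈ Q`. -/
theorem exists_add_mem_block {p : ℕ} (hp : p ∈ Q) {s : R} (hs : (p : R) * s = 0) (hs0 : s ≠ 0)
    {x : R} (hx : x ∉ I) : ∃ y ∈ I, s + y ∈ A.block x := by
  by_cases hex : ∃ z ∈ A.block x, ¬ p ∣ ({w | w ∈ A.block z ∧ p • w = p • z} : Set R).ncard
  · obtain ⟨z, hz, hd⟩ := hex
    obtain ⟨_, y, -, hy, -, hall⟩ := h.exists_split hp (h.notMem_of_mem_block hx hz) hd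
    exact ⟨y, hy, block_eq_of_mem hz ▸ hall s hs hs0⟩
  · push Not at hex
    exfalso
    have hsI : s ∉ I := fun hsI => hs0 (hI p hp s hsI hs)
    -- With all counts divisible by `p`, the block is invariant under `p`-torsion. The ideal of
    -- translations fixing it and its unit multiples then contains `s ∉ I`, so together with `I` it
    -- spans `R`, and some translation moves `x` into `I`.
    obtain ⟨K, hK, hm⟩ := exists_ideal_of_translations h.isOverRing h.closure_units
      {z | ∃ u : Rˣ, (u : R) * z ∈ A.block x} (by
        rintro v z ⟨u, hu⟩
        exact ⟨u * v⁻¹, by simpa [mul_assoc] using hu⟩)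
    have hsK : s ∈ K := by
      rw [hm]
      rintro z ⟨u, hu⟩ w hw
      have h1 := h.isOverRing.mul_mem_block u hw
      rw [block_eq_of_mem hu] at h1
      have h2 := h.add_mem_of_dvd hp (h.notMem_of_mem_block hx h1) (hex _ h1)
        (e := (u : R) * s) (by linear_combination (u : R) * hs)
      have h3 := h.isOverRing.mul_mem_block u⁻¹ h2
      rw [← mul_add] at h3
      simp only [Units.inv_mul_cancel_left] at h3
      rwa [block_eq_of_mem hw] at h3
    have htop := h.isMaximal.sup_eq_top hK (fun hle => hsI (hle hsK))
    obtain ⟨n, hn, i, hi, hni⟩ := Submodule.mem_sup.1 (htop ▸ Submodule.mem_top : x ∈ _)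
    have h4 := (hm _).1 (neg_mem hn) x ⟨1, by simpa using A.mem_block x⟩ x (A.mem_block x)
    rw [← hni, show n + i + -n = i by ring] at h4
    rw [hni] at h4
    exact h.notMem_of_mem_block hx h4 hi

/-- The fibre over `s` of a basic set outside `I` is an `A`-set. -/
theorem isASet_fibre {p : ℕ} (hp : p ∈ Q) {s : R} (hs : (p : R) * s = 0) (hs0 : s ≠ 0)
    {x : R} (hx : x ∉ I) : A.IsASet {y | y ∈ I ∧ s + y ∈ A.block x} := by
  have hpp := h.prime hp
  -- On `I` multiplication by `p` is that of a unit `u`, and `p • (s + y) = u • y`; so the fibre is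
  -- `u⁻¹` times the `A`-set of `IsASet.primePower`.
  obtain ⟨u, hu⟩ := exists_unit_mul_eq (a := (p : R)) (I := I) (hI p hp)
  have hW := h.isOverRing.smul ((isASet_block (A := A) x).primePower hpp) u⁻¹
  convert hW using 1
  ext y
  rw [Set.mem_inv_smul_set_iff]
  change _ ↔ ¬ p ∣ _
  constructor
  · rintro ⟨hyI, hy⟩ hd
    have hsy := h.notMem_of_mem_block hx hy
    have heq : u • y = p • (s + y) := by
      rw [Units.smul_def, smul_eq_mul, hu y hyI, nsmul_eq_mul]
      linear_combination -hs
    rw [heq, ← block_eq_of_mem hy] at hd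
    have := h.add_mem_of_dvd hp hsy hd (e := -s) (by linear_combination -hs)
    rw [show s + y + -s = y by ring] at this
    exact h.notMem_of_mem_block hsy this hyI
  · intro hd
    obtain ⟨w, hw, hwy⟩ : ({w | w ∈ A.block x ∧ p • w = u • y} : Set R).Nonempty := by
      by_contra hne
      rw [Set.not_nonempty_iff_eq_empty] at hne
      apply hd
      rw [hne]
      simp
    rw [← hwy, ← block_eq_of_mem hw] at hd
    obtain ⟨e, y', he, hy', hwe, hall⟩ := h.exists_split hp (h.notMem_of_mem_block hx hw) hd
    have hyy : y = y' := by
      have h1 : u • y' = u • y := by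
        rw [← hwy, hwe, Units.smul_def, smul_eq_mul, hu y' hy', nsmul_eq_mul]
        linear_combination -he
      exact (smul_left_cancel u h1).symm
    subst hyy
    exact ⟨hy', block_eq_of_mem hw ▸ hall s hs hs0⟩

/-- A basic set outside `I` meets all cosets of `I` outside `I` in the same number of elements. -/
theorem ncard_inter_coset {x g g' : R} (hg : g ∉ I) (hg' : g' ∉ I) :
    ({w | w ∈ A.block x ∧ g - w ∈ I} : Set R).ncard =
      ({w | w ∈ A.block x ∧ g' - w ∈ I} : Set R).ncard := by
  obtain ⟨p, hp⟩ := h.exists_mem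
  obtain ⟨s, hs0, hs⟩ := h.exists_torsion hp
  have key : ∀ g ∉ I, ({w | w ∈ A.block x ∧ g - w ∈ I} : Set R).ncard =
      ({w | w ∈ A.block x ∧ s - w ∈ I} : Set R).ncard := by
    intro g hg
    -- The count is constant on the block of `g`, and that block has a point in `s + I`.
    obtain ⟨y, hy, hsy⟩ := h.exists_add_mem_block hI hp hs hs0 hg
    have h1 : ({w | w ∈ A.block x ∧ s + y - w ∈ I} : Set R) =
        {w | w ∈ A.block x ∧ s - w ∈ I} := by
      ext w
      rw [Set.mem_ofPred_eq, Set.mem_ofPred_eq, show s + y - w = s - w + y by ring,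
        add_mem_cancel_right hy]
    rw [← h1]
    exact IsASet.ncard_eq (isASet_block x) h.isAIdeal (A.block_mem g) (A.mem_block g) hsy
  rw [key g hg, key g' hg']

theorem exists_mem_block_sub_mem {x g : R} (hx : x ∉ I) (hg : g ∉ I) :
    ∃ w ∈ A.block x, g - w ∈ I := by
  have h1 := h.ncard_inter_coset hI (x := x) hg hx
  have h2 : 0 < ({w | w ∈ A.block x ∧ x - w ∈ I} : Set R).ncard :=
    (Set.ncard_pos).2 ⟨x, A.mem_block x, by simp⟩
  rw [← h1, Set.ncard_pos] at h2
  exact h2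

variable {p : ℕ} (hp : p ∈ Q) {s : R} (hs : (p : R) * s = 0) (hs0 : s ≠ 0)
include hp hs hs0

/-- The left set lies in the right one. Both sizes are independent of `τ` in the block of `s`, the
left one because the fibre is an `A`-set, and at `τ = s` the two sets coincide. -/
theorem setOf_translate_eq {x τ : R} (hx : x ∉ I) (hτ : τ ∈ A.block s) :
    ({w | w ∈ A.block x ∧ τ - w ∈ -{y | y ∈ I ∧ s + y ∈ A.block x}} : Set R) =
      {w | w ∈ A.block x ∧ τ - w ∈ I} := by
  have hsI : s ∉ I := fun hsI => hs0 (hI p hp s hsI hs)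
  refine Set.eq_of_subset_of_ncard_le (fun w hw => ⟨hw.1, ?_⟩) (le_of_eq ?_)
  · have h1 : -(τ - w) ∈ I := hw.2.1
    simpa using neg_mem h1
  · rw [h.ncard_inter_coset hI (h.notMem_of_mem_block hsI hτ) hsI,
      IsASet.ncard_eq (isASet_block x) (h.isASet_fibre hI hp hs hs0 hx).neg (A.block_mem s)
        hτ (A.mem_block s)]
    congr 1
    ext w
    constructor
    · rintro ⟨hw, hwI⟩
      refine ⟨hw, by simpa using neg_mem hwI, ?_⟩
      rwa [show s + -(s - w) = w by ring]
    · rintro ⟨hw, hwI, -⟩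
      exact ⟨hw, by simpa using neg_mem hwI⟩

theorem sub_add_mem_block {x τ w : R} (hx : x ∉ I) (hτ : τ ∈ A.block s) (hw : w ∈ A.block x)
    (hwI : τ - w ∈ I) : s + (w - τ) ∈ A.block x := by
  have hmem : w ∈ {w | w ∈ A.block x ∧ τ - w ∈ I} := ⟨hw, hwI⟩
  rw [← h.setOf_translate_eq hI hp hs hs0 hx hτ] at hmem
  have := hmem.2.2
  rwa [neg_sub] at this

/-- Converse of `sub_add_mem_block`: translation by `s - τ` injects the part of the block in `τ + I`
into the part in `s + I`, and these have equal size. -/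
theorem add_mem_block {x τ y : R} (hx : x ∉ I) (hτ : τ ∈ A.block s) (hy : y ∈ I)
    (hsy : s + y ∈ A.block x) : τ + y ∈ A.block x := by
  have hsI : s ∉ I := fun hsI => hs0 (hI p hp s hsI hs)
  have himg : (fun w => s + (w - τ)) '' {w | w ∈ A.block x ∧ τ - w ∈ I} =
      {w | w ∈ A.block x ∧ s - w ∈ I} := by
    refine Set.eq_of_subset_of_ncard_le ?_ (le_of_eq ?_)
    · rintro _ ⟨w, ⟨hw, hwI⟩, rfl⟩
      exact ⟨h.sub_add_mem_block hI hp hs hs0 hx hτ hw hwI, by simpa using hwI⟩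
    · rw [Set.ncard_image_of_injective _ (fun a b hab => by simpa using hab)]
      exact h.ncard_inter_coset hI hsI (h.notMem_of_mem_block hsI hτ)
  have hmem : s + y ∈ {w | w ∈ A.block x ∧ s - w ∈ I} := ⟨hsy, by simpa using hy⟩
  rw [← himg] at hmem
  obtain ⟨w, hw, hwy⟩ := hmem
  have : τ + y = w := by linear_combination -hwy
  rw [this]
  exact hw.1

/-- Differences in `I` of elements of the basic set of `s` fix all basic sets outside `I`. -/
theorem add_sub_mem_block {τ τ' x : R} (hτ : τ ∈ A.block s) (hτ' : τ' ∈ A.block s)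
    (hI' : τ - τ' ∈ I) (hx : x ∉ I) : x + (τ - τ') ∈ A.block x := by
  have hsI : s ∉ I := fun hsI => hs0 (hI p hp s hsI hs)
  have h1 : s + (τ - τ') ∈ A.block s :=
    h.sub_add_mem_block hI hp hs hs0 hsI hτ' hτ (by simpa using neg_mem hI')
  -- Take the point `ρ` of the block of `s` in the coset of `x`. The fibre of the block of `x` is
  -- the same over `s`, over `s + (τ - τ')` and over `ρ`, so it is invariant under `τ - τ'`.
  obtain ⟨ρ, hρ, hxρ⟩ := h.exists_mem_block_sub_mem hI hsI hx
  have h2 := h.sub_add_mem_block hI hp hs hs0 hx hρ (A.mem_block x) (by simpa using neg_mem hxρ)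
  have h3 := h.add_mem_block hI hp hs hs0 hx h1 hxρ h2
  have h4 := h.add_mem_block hI hp hs hs0 hx hρ (add_mem hI' hxρ) (by rwa [← add_assoc])
  rwa [show ρ + (τ - τ' + (x - ρ)) = x + (τ - τ') by ring] at h4

end Disjoint

/-! ### The `Q`-component as an `A`-ideal -/

/-- Its order is coprime to `|R ⧸ I|`, so its image in the quotient is zero. -/
theorem componentOne_compl_mem : 1 - componentOne R Q ∈ I := by
  have h1 := one_sub_componentOne_mem (R := R) Q
  set f := 1 - componentOne R Q
  set k := addOrderOf f with hk
  have hcop : Nat.Coprime k (Nat.card (R ⧸ I)) := by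
    refine Nat.coprime_of_dvd fun q hq hqk hqc => h1 q hq hqk ?_
    rw [h.primes_eq]
    exact Nat.mem_primeFactors.2 ⟨hq, hqc, Nat.card_pos.ne'⟩
  have hn : Nat.card (R ⧸ I) • f ∈ I := by
    rw [← Ideal.Quotient.eq_zero_iff_mem, map_nsmul, card_nsmul_eq_zero']
  have hk0 : k • f = 0 := addOrderOf_nsmul_eq_zero f
  obtain ⟨a, b, hab⟩ := (Nat.isCoprime_iff_coprime.2 hcop : IsCoprime (k : ℤ) _)
  have hab' : (a : R) * k + (b : R) * (Nat.card (R ⧸ I) : ℕ) = 1 := by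
    exact_mod_cast congrArg (Int.cast : ℤ → R) hab
  have hf : f = (b : R) * (Nat.card (R ⧸ I) • f) := by
    rw [nsmul_eq_mul] at hk0 ⊢
    linear_combination (-f) * hab' + (a : R) * hk0
  rw [hf]
  exact I.mul_mem_left _ hn

theorem mem_componentIdeal_of_torsion {p : ℕ} (hp : p ∈ Q) {s : R} (hs : (p : R) * s = 0) :
    s ∈ componentIdeal R Q := by
  intro q hq hd
  rw [← nsmul_eq_mul] at hs
  have := hd.trans (addOrderOf_dvd_of_nsmul_eq_zero hs)
  rwa [(Nat.prime_dvd_prime_iff_eq hq (h.prime hp)).1 this]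

theorem torsion_eq_zero_of_trivial (hM : ∀ m, (∀ x ∉ I, x + m ∈ A.block x) → m = 0) :
    ∀ p ∈ Q, ∀ f ∈ I, (p : R) * f = 0 → f = 0 := by
  intro p hp f hfI hf
  by_contra hf0
  exact hf0 (hM f fun x hx => h.add_mem_of_torsion_mem hp hfI hf hf0 hx hf)

/-- If no non-zero translation fixes all basic sets outside `I`, then `R_Q` is an `A`-ideal
complementing `I`. -/
theorem isAIdeal_componentIdeal (hM : ∀ m, (∀ x ∉ I, x + m ∈ A.block x) → m = 0) :
    A.IsAIdeal (componentIdeal R Q) ∧ I ⊓ componentIdeal R Q = ⊥ := by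
  have hI := h.torsion_eq_zero_of_trivial hM
  have hdisj : ∀ y ∈ I, y ∈ componentIdeal R Q → y = 0 := fun y hy hyQ =>
    eq_zero_of_forall_prime hI hy hyQ
  obtain ⟨p, hp⟩ := h.exists_mem
  obtain ⟨s, hs0, hs⟩ := h.exists_torsion hp
  have hsI : s ∉ I := fun hsI => hs0 (hI p hp s hsI hs)
  have hsQ := h.mem_componentIdeal_of_torsion hp hs
  have huniq : ∀ τ ∈ A.block s, ∀ τ' ∈ A.block s, τ - τ' ∈ I → τ = τ' := by
    intro τ hτ τ' hτ' hd
    exact sub_eq_zero.1 (hM _ fun x hx => h.add_sub_mem_block hI hp hs hs0 hτ hτ' hd hx)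
  set ε := componentOne R Q with hε
  have hεε : ε * ε = ε := componentOne_mul_self Q
  have hεI := h.componentOne_compl_mem
  have hεQ : ∀ r, ε * r ∈ componentIdeal R Q := fun r =>
    Ideal.mul_mem_right r _ (componentOne_mem R Q)
  have hres : ∀ τ, (1 - ε) * τ ∈ I := fun τ => Ideal.mul_mem_right τ _ hεI
  have htwo : ∀ τ ∈ A.block s, 2 * ((1 - ε) * τ) = 0 := by
    intro τ hτ
    -- This unit is 1 on `R_Q` and `-1` on the complement. It fixes `s`, hence its block, and moves
    -- `τ` only within its coset of `I`; by `huniq` it fixes `τ`.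
    let u : Rˣ := Units.mkOfMulEqOne (2 * ε - 1) (2 * ε - 1) (by linear_combination 4 * hεε)
    have hus : (u : R) * s = s := by
      change (2 * ε - 1) * s = s
      linear_combination 2 * componentOne_mul R Q hsQ
    have huτ := h.isOverRing.mul_mem_block u hτ
    rw [hus] at huτ
    have hsub : τ - (2 * ε - 1) * τ = 2 * ((1 - ε) * τ) := by ring
    have := huniq τ hτ _ huτ (by
      change τ - (2 * ε - 1) * τ ∈ I
      rw [hsub]
      exact I.mul_mem_left _ (hres τ))
    rw [← hsub]
    exact sub_eq_zero.2 this
  have hsubset : A.block s ⊆ componentIdeal R Q := by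
    by_cases h2 : 2 ∈ Q
    · intro τ hτ
      have h0 := hI 2 h2 _ (hres τ) (by exact_mod_cast htwo τ hτ)
      have : τ = ε * τ := by linear_combination h0
      rw [this]
      exact hεQ τ
    -- If `2 ∉ Q`, the part of `τ` outside `R_Q` may be 2-torsion. Doubling removes it and acts on
    -- `R_Q` as a unit `u`, so the Frobenius argument for the prime 2 compares the block of `s` with
    -- its projection to `R_Q`.
    · have hinj : ∀ z ∈ componentIdeal R Q, 2 * z = 0 → z = 0 := by
        intro z hz h2z
        have h2z' : 2 • z = 0 := by rw [nsmul_eq_mul]; exact_mod_cast h2z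
        rcases (Nat.dvd_prime Nat.prime_two).1 (addOrderOf_dvd_of_nsmul_eq_zero h2z') with h3 | h3
        · exact AddMonoid.addOrderOf_eq_one_iff.1 h3
        · exact absurd (hz 2 Nat.prime_two h3.symm.dvd) h2
      obtain ⟨u, hu⟩ := exists_unit_mul_eq hinj
      have hτ2 : ∀ τ ∈ A.block s, 2 • τ = (u : R) * (ε * τ) := by
        intro τ hτ
        rw [hu _ (hεQ τ), nsmul_eq_mul]
        push_cast
        linear_combination htwo τ hτ
      have hW := (isASet_block (A := A) s).primePower Nat.prime_two
      have hsW : (u : R) * s ∈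
          {g | ¬ 2 ∣ ({w | w ∈ A.block s ∧ 2 • w = g} : Set R).ncard} := by
        have hone : ({w | w ∈ A.block s ∧ 2 • w = (u : R) * s} : Set R) = {s} := by
          refine Set.Subset.antisymm ?_ ?_
          · rintro w ⟨hw, hw2⟩
            rw [hτ2 w hw] at hw2
            have h5 : ε * w = s := u.isUnit.mul_left_cancel hw2
            refine huniq w hw s (A.mem_block s) ?_
            rw [show w - s = (1 - ε) * w by linear_combination h5]
            exact hres w
          · rintro _ rfl
            refine ⟨A.mem_block _, ?_⟩
            rw [hτ2 _ (A.mem_block _), componentOne_mul R Q hsQ]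
        rw [Set.mem_ofPred_eq, hone, Set.ncard_singleton]
        norm_num
      intro τ hτ
      -- The `A`-set of elements with an odd number of halves contains `u * s`, hence also `u * τ`;
      -- a half `w` of the latter gives `τ = ε * w`.
      have h6 := hW.subset (A.block_mem _) (A.mem_block _) hsW (h.isOverRing.mul_mem_block u hτ)
      obtain ⟨w, hw, hw2⟩ : ({w | w ∈ A.block s ∧ 2 • w = (u : R) * τ} : Set R).Nonempty := by
        by_contra hne
        rw [Set.not_nonempty_iff_eq_empty] at hne
        apply h6
        rw [hne]
        simp
      rw [hτ2 w hw] at hw2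
      rw [← (u.isUnit.mul_left_cancel hw2 : ε * w = τ)]
      exact hεQ w
  refine ⟨isASet_iff_block.2 fun z hz => ?_, ?_⟩
  · by_cases hz0 : z = 0
    · subst hz0
      rw [block_zero]
      simp
    -- Every non-zero `z ∈ R_Q` agrees modulo `I` with a point of the block of `s`, and both lie in
    -- `R_Q`, which is disjoint from `I`. So `R_Q` is that block together with 0.
    · obtain ⟨τ, hτ, hd⟩ := h.exists_mem_block_sub_mem hI hsI (g := z)
        (fun hzI => hz0 (hdisj z hzI hz))
      have : z = τ := sub_eq_zero.1 (hdisj _ hd (sub_mem hz (hsubset hτ)))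
      rw [this, block_eq_of_mem hτ]
      exact hsubset
  · exact (Submodule.eq_bot_iff _).2 fun y hy => hdisj y hy.1 hy.2

end IsTorsionSaturated

end SchurRing

/-! ### Arithmetic of CG-rings -/

section Galois

variable {R : Type*} [CommRing R]

theorem componentUnits_mono {Q Q' : Set ℕ} (h : Q ⊆ Q') :
    componentUnits R Q ≤ componentUnits R Q' :=
  fun _ hu p hp hd => h (hu p hp hd)

variable [Finite R]

theorem componentOne_ne_zero {p : ℕ} (hp : p ∈ (Nat.card R).primeFactors) :
    componentOne R {p} ≠ 0 := by
  intro h0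
  have hpp := Nat.prime_of_mem_primeFactors hp
  have : Fact p.Prime := ⟨hpp⟩
  obtain ⟨e, he⟩ := exists_prime_addOrderOf_dvd_card' p (Nat.dvd_of_mem_primeFactors hp)
  have hmem : e ∈ componentIdeal R {p} := by
    intro q hq hd
    rw [he] at hd
    exact (Nat.prime_dvd_prime_iff_eq hq hpp).1 hd
  have h1 := componentOne_mul R {p} hmem
  rw [h0, zero_mul] at h1
  rw [← h1, addOrderOf_zero] at he
  exact hpp.ne_one he.symm

theorem exists_pow_mul_componentOne (p : ℕ) :
    ∃ n : ℕ, (p : R) ^ n * componentOne R {p} = 0 := by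
  have h1 : ∃ n, addOrderOf (componentOne R {p}) = p ^ n :=
    ⟨_, Nat.eq_prime_pow_of_unique_prime_dvd (addOrderOf_pos _).ne'
      fun {q} hq hd => componentOne_mem R {p} q hq hd⟩
  obtain ⟨n, hn⟩ := h1
  refine ⟨n, ?_⟩
  have := addOrderOf_nsmul_eq_zero (componentOne R {p})
  rw [hn, nsmul_eq_mul] at this
  exact_mod_cast this

/-- Iterating the equation would make `1_p` divisible by every power of `p`, but `p` is nilpotent on
`R_p`. -/
theorem componentOne_mul_ne {p : ℕ} (hp : p ∈ (Nat.card R).primeFactors) (a : R) :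
    componentOne R {p} ≠ p * (componentOne R {p} * a) := by
  intro h
  set ε := componentOne R {p}
  have hpow : ∀ n : ℕ, ε = (p : R) ^ n * ε * a ^ n := by
    intro n
    induction n with
    | zero => simp
    | succ n ih => linear_combination ih + ((p : R) ^ n * a ^ n) * h
  obtain ⟨n, hn⟩ := exists_pow_mul_componentOne (R := R) p
  exact componentOne_ne_zero hp ((hpow n).trans (by rw [hn, zero_mul]))

/-- In a CG-ring, the `p`-component of an element is either invertible or divisible by `p`. -/
theorem IsCGRing.unit_or_dvd (hR : IsCGRing R) {p : ℕ} (hp : p ∈ (Nat.card R).primeFactors)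
    (r : R) : (∃ u ∈ componentUnits R {p}, componentOne R {p} * u = componentOne R {p} * r) ∨
      ∃ a, componentOne R {p} * r = p * (componentOne R {p} * a) := by
  obtain ⟨-, hloc, q, hq, hjac⟩ := hR p hp
  have hpp := Nat.prime_of_mem_primeFactors hp
  have hval : ∀ (n : ℕ) (s : Component R {p}), ((n * s : Component R {p})).1 = n * s.1 := by
    intro n s
    rw [← nsmul_eq_mul, ← nsmul_eq_mul]
    exact map_nsmul (componentIdeal R {p}).toAddSubgroup.subtype n s
  rw [IsLocalRing.jacobson_eq_maximalIdeal _ bot_ne_top] at hjac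
  -- The prime generating the radical must be `p`: since `p` is nilpotent in `R_p`, a different `q`
  -- would put 1 into the maximal ideal.
  have hqp : q = p := by
    by_contra hne
    obtain ⟨n, hn⟩ := exists_pow_mul_componentOne (R := R) p
    have hpm : (p : Component R {p}) ∈ IsLocalRing.maximalIdeal (Component R {p}) := by
      have hpn : (p : Component R {p}) ^ n = 0 := by
        have h1 := hval (p ^ n) 1
        rw [mul_one] at h1
        refine Subtype.ext ?_
        rw [← Nat.cast_pow, h1]
        push_cast
        exact hn
      exact (IsLocalRing.maximalIdeal.isMaximal _).isPrime.mem_of_pow_mem n (hpn ▸ Ideal.zero_mem _)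
    have hqm : (q : Component R {p}) ∈ IsLocalRing.maximalIdeal (Component R {p}) :=
      hjac ▸ Ideal.mem_span_singleton_self _
    obtain ⟨a, b, hab⟩ := (Nat.isCoprime_iff_coprime.2 ((Nat.coprime_primes hq hpp).2 hne) :
      IsCoprime (q : ℤ) (p : ℤ))
    have hab' : (a : Component R {p}) * q + (b : Component R {p}) * p = 1 := by
      exact_mod_cast congrArg (Int.cast : ℤ → Component R {p}) hab
    refine (Ideal.ne_top_iff_one _).1
      (IsLocalRing.maximalIdeal.isMaximal (Component R {p})).ne_top ?_
    rw [← hab']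
    exact add_mem (Ideal.mul_mem_left _ _ hqm) (Ideal.mul_mem_left _ _ hpm)
  subst hqp
  have hmem : componentOne R {q} * r ∈ componentIdeal R {q} :=
    Ideal.mul_mem_right r _ (componentOne_mem R {q})
  let s : Component R {q} := ⟨componentOne R {q} * r, hmem⟩
  by_cases hs : IsUnit s
  · left
    obtain ⟨v, hv⟩ := hs
    have hv1 : componentOne R {q} * (v : Component R {q}).1 = (v : Component R {q}).1 :=
      componentOne_mul R {q} (v : Component R {q}).2
    have hw1 : componentOne R {q} * ((v⁻¹ : (Component R {q})ˣ) : Component R {q}).1 =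
        ((v⁻¹ : (Component R {q})ˣ) : Component R {q}).1 :=
      componentOne_mul R {q} ((v⁻¹ : (Component R {q})ˣ) : Component R {q}).2
    have hvw : (v : Component R {q}).1 * ((v⁻¹ : (Component R {q})ˣ) : Component R {q}).1 =
        componentOne R {q} := congrArg Subtype.val v.mul_inv
    have hee := componentOne_mul_self (R := R) {q}
    refine ⟨Units.mkOfMulEqOne ((v : Component R {q}).1 + (1 - componentOne R {q}))
      (((v⁻¹ : (Component R {q})ˣ) : Component R {q}).1 + (1 - componentOne R {q})) ?_, ?_, ?_⟩
    · linear_combination hvw - hv1 - hw1 + hee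
    · exact (mem_componentUnits_iff R {q} _).2 ⟨v, rfl⟩
    · have hvs : (v : Component R {q}).1 = componentOne R {q} * r := congrArg Subtype.val hv
      change componentOne R {q} * ((v : Component R {q}).1 + (1 - componentOne R {q})) = _
      linear_combination hv1 + hvs - hee
  · right
    have hsm : s ∈ IsLocalRing.maximalIdeal (Component R {q}) := (IsLocalRing.mem_maximalIdeal s).2 hs
    rw [hjac] at hsm
    obtain ⟨t, ht⟩ := Ideal.mem_span_singleton'.1 hsm
    refine ⟨t.1, ?_⟩
    have h1 : s.1 = q * t.1 := by rw [← ht, mul_comm, hval]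
    rw [componentOne_mul R {q} t.2]
    exact h1

/-- A CG-ring is additively generated by its units. -/
theorem IsCGRing.closure_units (hR : IsCGRing R) :
    AddSubgroup.closure {r : R | IsUnit r} = ⊤ := by
  set M := AddSubgroup.closure {r : R | IsUnit r} with hM
  have hunit : ∀ u : Rˣ, (u : R) ∈ M := fun u => AddSubgroup.subset_closure u.isUnit
  have key : ∀ p ∈ (Nat.card R).primeFactors, ∀ r : R, ∃ d : ℕ, ¬ p ∣ d ∧ d • r ∈ M := by
    intro p hp r
    have hpp := Nat.prime_of_mem_primeFactors hp
    refine ⟨addOrderOf (1 - componentOne R {p}),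
      (mem_componentIdeal_compl_singleton hpp).1 (one_sub_componentOne_mem {p}), ?_⟩
    have h0 := addOrderOf_nsmul_eq_zero (1 - componentOne R {p})
    set d := addOrderOf (1 - componentOne R {p})
    rw [nsmul_eq_mul] at h0
    have hd : ∀ r : R, ∀ u : Rˣ, componentOne R {p} * u = componentOne R {p} * r →
        d • r ∈ M := by
      intro r u hu
      have : d • r = d • (u : R) := by
        rw [nsmul_eq_mul, nsmul_eq_mul]
        linear_combination (r - u) * h0 - (d : R) * hu
      rw [this]
      exact nsmul_mem (hunit u) d
    -- Locality: `r` or `1 - r` has an invertible `p`-component, and the multiplier `d`, prime to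
    -- `p`, kills the other components.
    rcases hR.unit_or_dvd hp r with ⟨u, -, hu⟩ | ⟨a, ha⟩
    · exact hd r u hu
    · rcases hR.unit_or_dvd hp (1 - r) with ⟨u, -, hu⟩ | ⟨b, hb⟩
      · have h1 := hd _ u hu
        rw [smul_sub] at h1
        simpa using sub_mem (nsmul_mem (hunit 1) d) h1
      · exact absurd (by linear_combination ha + hb) (componentOne_mul_ne hp (a + b))
  rw [eq_top_iff]
  intro r _
  by_contra hr
  have hne : addOrderOf (r : R ⧸ M) ≠ 1 := fun h1 =>
    hr ((QuotientAddGroup.eq_zero_iff r).1 (AddMonoid.addOrderOf_eq_one_iff.1 h1))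
  obtain ⟨p, hp, hpd⟩ := Nat.exists_prime_and_dvd hne
  have hcard : p ∣ Nat.card R := hpd.trans
    ((addOrderOf_dvd_natCard _).trans (AddSubgroup.card_quotient_dvd_card M))
  obtain ⟨d, hd, hdr⟩ := key p (Nat.mem_primeFactors.2 ⟨hp, hcard, Nat.card_pos.ne'⟩) r
  refine hd (hpd.trans (addOrderOf_dvd_of_nsmul_eq_zero ?_))
  exact (QuotientAddGroup.eq_zero_iff (d • r)).2 hdr

/-- Divide by `p` until a unit appears; nilpotency of `p` on `R_p` bounds the process. -/
theorem IsCGRing.exists_eq_pow_mul (hR : IsCGRing R) {p : ℕ}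
    (hp : p ∈ (Nat.card R).primeFactors) (r : R) : componentOne R {p} * r = 0 ∨
      ∃ k : ℕ, ∃ u ∈ componentUnits R {p},
        componentOne R {p} * r = p ^ k * (componentOne R {p} * u) := by
  have key : ∀ n : ℕ, (∃ k : ℕ, ∃ u ∈ componentUnits R {p},
      componentOne R {p} * r = p ^ k * (componentOne R {p} * u)) ∨
      ∃ a, componentOne R {p} * r = p ^ n * (componentOne R {p} * a) := by
    intro n
    induction n with
    | zero => exact Or.inr ⟨r, by simp⟩
    | succ n ih =>
      rcases ih with h | ⟨a, ha⟩
      · exact Or.inl h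
      · rcases hR.unit_or_dvd hp a with ⟨u, hu, hua⟩ | ⟨b, hb⟩
        · exact Or.inl ⟨n, u, hu, by rw [hua, ha]⟩
        · exact Or.inr ⟨b, by rw [ha, hb]; ring⟩
  obtain ⟨n, hn⟩ := exists_pow_mul_componentOne (R := R) p
  rcases key n with h | ⟨a, ha⟩
  · exact Or.inr h
  · exact Or.inl (by rw [ha, ← mul_assoc, hn, zero_mul])

/-- Modulo an ideal `L` of a CG-ring, adding an element of order `p` amounts to multiplying by a
unit, as long as `p`-components do not vanish. -/
theorem IsCGRing.exists_unit_sub_mem (hR : IsCGRing R) {p : ℕ}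
    (hp : p ∈ (Nat.card R).primeFactors) {L : Ideal R} {x e : R} (he : (p : R) * e ∈ L)
    (hx : componentOne R {p} * x ∉ L) (hxe : componentOne R {p} * (x + e) ∉ L) :
    ∃ u ∈ componentUnits R {p}, (u : R) * x - (x + e) ∈ L := by
  have hpp := Nat.prime_of_mem_primeFactors hp
  have hcop : ¬ p ∣ addOrderOf (1 - componentOne R {p}) :=
    (mem_componentIdeal_compl_singleton hpp).1 (one_sub_componentOne_mem {p})
  have h0 := addOrderOf_nsmul_eq_zero (1 - componentOne R {p})
  set d := addOrderOf (1 - componentOne R {p})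
  rw [nsmul_eq_mul] at h0
  have hee := componentOne_mul_self (R := R) {p}
  have hunits : ∀ u ∈ componentUnits R {p},
      componentOne R {p} * ((u : R) - 1) = (u : R) - 1 := fun u hu => componentOne_mul R {p} hu
  set ε := componentOne R {p}
  obtain ⟨a, b, hab⟩ := (Nat.isCoprime_iff_coprime.2 (hpp.coprime_iff_not_dvd.2 hcop) :
    IsCoprime (p : ℤ) (d : ℤ))
  have hab' : (a : R) * p + (b : R) * d = 1 := by exact_mod_cast congrArg (Int.cast : ℤ → R) hab
  have hres : (1 - ε) * e ∈ L := by
    have : (1 - ε) * e = (a : R) * (1 - ε) * (p * e) := by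
      linear_combination (-(1 - ε) * e) * hab' + (b : R) * e * h0
    rw [this]
    exact L.mul_mem_left _ he
  suffices hs : ∃ u ∈ componentUnits R {p}, ε * ((u : R) * x) = ε * (x + e) by
    obtain ⟨u, hu, h1⟩ := hs
    refine ⟨u, hu, ?_⟩
    have : (u : R) * x - (x + e) = -((1 - ε) * e) := by
      linear_combination h1 - x * hunits u hu
    rw [this]
    exact neg_mem hres
  rcases hR.exists_eq_pow_mul hp e with h1 | ⟨m, w, -, hw⟩
  · exact ⟨1, one_mem _, by rw [Units.val_one]; linear_combination -h1⟩
  rcases hR.exists_eq_pow_mul hp x with h2 | ⟨k, v, hv, hk⟩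
  · exact absurd (h2 ▸ L.zero_mem) hx
  -- Since `e` has `p`-component `p ^ m` times a unit and `p * e ∈ L`, the ideal `L` contains `p ^
  -- (m + 1) R_p`; so `x` cannot be divisible by more than `p ^ m`.
  have hpm : ∀ j, m + 1 ≤ j → ∀ c, (p : R) ^ j * (ε * c) ∈ L := by
    intro j hj c
    obtain ⟨i, rfl⟩ := Nat.exists_eq_add_of_le hj
    have : (p : R) ^ (m + 1 + i) * (ε * c) = (p ^ i * c * (w⁻¹ : Rˣ) * ε) * (p * e) := by
      have hwi := w.mul_inv
      linear_combination (-(p : R) ^ i * c * (w⁻¹ : Rˣ) * p) * hw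
        - ((p : R) ^ (m + 1 + i) * (ε * c)) * hwi
    rw [this]
    exact L.mul_mem_left _ he
  have hkm : k ≤ m := by
    by_contra hlt
    exact hx (hk ▸ hpm k (by omega) v)
  obtain ⟨j, rfl⟩ := Nat.exists_eq_add_of_le hkm
  have hsum : ε * (x + e) = p ^ k * (ε * (v + p ^ j * w)) := by
    linear_combination hk + hw
  rcases hR.unit_or_dvd hp ((v : R) + p ^ j * w) with ⟨u, hu, huv⟩ | ⟨c, hc⟩
  · refine ⟨u * v⁻¹, mul_mem hu (inv_mem hv), ?_⟩
    rw [hsum, ← huv]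
    push_cast
    have hvi := v.mul_inv
    linear_combination ((u : R) * (v⁻¹ : Rˣ)) * hk + (u * p ^ k * ε) * hvi
  -- If `v + p ^ j * w` is not a unit at `p`, then either `j = 0` and `x + e` has its `p`-component
  -- in `L`, or `j > 0` and the unit `v` would be divisible by `p`.
  · exfalso
    rcases Nat.eq_zero_or_pos j with rfl | hj
    · refine hxe ?_
      rw [hsum, hc]
      have := hpm (k + 0 + 1) le_rfl c
      rwa [show (p : R) ^ (k + 0 + 1) * (ε * c) = p ^ k * (p * (ε * c)) by ring] at this
    · obtain ⟨i, rfl⟩ := Nat.exists_eq_add_of_le' hj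
      refine componentOne_mul_ne hp ((c - p ^ i * w) * (v⁻¹ : Rˣ)) ?_
      have hvi := v.mul_inv
      linear_combination (v⁻¹ : Rˣ) * hc - ε * hvi

end Galois

/-! ### From rationality to saturation, and the tensor decomposition -/

namespace SchurRing

variable {R : Type*} [CommRing R] [Finite R] {A : SchurRing R}

/-- Saturation in the image only needs torsion modulo `ker f`, which `IsCGRing.exists_unit_sub_mem`
handles with `L = ker f`: `x + e` becomes a unit multiple of `x` by an element of `R_Q^×`. Used for
the identity and for the quotient by the translation ideal. -/
theorem IsTorsionSaturated.of_surjective {S : Type*} [CommRing S] [Finite S] (hR : IsCGRing R)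
    (hA : A.IsOverRing) {f : R →+* S} (hf : Function.Surjective f) {B : SchurRing S}
    (hB : ∀ x, B.block (f x) = f '' A.block x) {I : Ideal S} {Q : Set ℕ}
    (hI : A.IsMaximalAIdeal (I.comap f))
    (hQ : Q = ↑(Nat.card (R ⧸ I.comap f)).primeFactors)
    (hrat : ∀ X ∈ A.basicSets, X ⊆ (I.comap f : Set R)ᶜ → IsQRational Q X) :
    B.IsTorsionSaturated I Q := by
  have hideal : ∀ K : Ideal S, B.IsAIdeal K ↔ A.IsAIdeal (K.comap f) := by
    intro K
    unfold IsAIdeal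
    rw [isASet_iff_block, isASet_iff_block]
    constructor
    · intro h x hx y hy
      have := h (f x) hx
      rw [hB] at this
      exact this ⟨y, hy, rfl⟩
    · intro h x hx
      obtain ⟨x, rfl⟩ := hf x
      rw [hB]
      rintro _ ⟨y, hy, rfl⟩
      exact h x hx hy
  refine ⟨?_, ?_, ⟨⟨(hideal I).2 hI.prop.1, ?_⟩, ?_⟩, ?_, ?_⟩
  · rw [eq_top_iff, ← AddSubgroup.map_top_of_surjective (f : R →+ S) hf, ← hR.closure_units,
      AddMonoidHom.map_closure]
    refine AddSubgroup.closure_mono ?_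
    rintro _ ⟨r, hr, rfl⟩
    exact IsUnit.map f hr
  · intro u X hX
    obtain ⟨v, hv⟩ := exists_unit_map_eq f hf u
    obtain ⟨y, hy⟩ := Setoid.nonempty_of_mem_partition B.isPartition hX
    obtain ⟨x, rfl⟩ := hf y
    have hvx : A.block ((v : R) * x) = v • A.block x :=
      block_eq (hA v _ (A.block_mem x)) (Set.smul_mem_smul_set (A.mem_block x))
    have : u • X = B.block (f (v * x)) := by
      rw [hB, hvx, ← block_eq hX hy, hB, ← Set.image_smul, ← Set.image_smul, Set.image_image,
        Set.image_image]
      refine Set.image_congr fun a _ => ?_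
      rw [Units.smul_def, Units.smul_def, smul_eq_mul, smul_eq_mul, map_mul, hv]
    rw [this]
    exact B.block_mem _
  · rintro rfl
    exact hI.prop.2 Ideal.comap_top
  · rintro K ⟨hK, hK1⟩ hIK
    refine (Ideal.comap_le_comap_iff_of_surjective f hf _ _).1
      (hI.le_of_ge ⟨(hideal K).1 hK, ?_⟩ (Ideal.comap_mono hIK))
    rwa [Ne, Ideal.comap_eq_top_iff]
  · have hg : Function.Surjective ((Ideal.Quotient.mk I).comp f) :=
      Ideal.Quotient.mk_surjective.comp hf
    have hker : RingHom.ker ((Ideal.Quotient.mk I).comp f) = I.comap f := by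
      ext x
      simp [RingHom.mem_ker, Ideal.Quotient.eq_zero_iff_mem]
    rw [hQ, ← hker, Nat.card_congr (RingHom.quotientKerEquivOfSurjective hg).toEquiv]
  · intro p hp y e hy he hyp hyep
    obtain ⟨x, rfl⟩ := hf y
    obtain ⟨e, rfl⟩ := hf e
    rw [hQ] at hp
    have hpp := Nat.prime_of_mem_primeFactors hp
    have hpR : p ∈ (Nat.card R).primeFactors :=
      Nat.mem_primeFactors.2 ⟨hpp, (Nat.dvd_of_mem_primeFactors hp).trans
        (AddSubgroup.card_quotient_dvd_card (I.comap f).toAddSubgroup), Nat.card_pos.ne'⟩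
    have hout : ∀ z : R, f z ∉ componentIdeal S {p}ᶜ →
        componentOne R {p} * z ∉ RingHom.ker f := by
      intro z hz hzk
      refine hz (mem_componentIdeal_compl_singleton_of_nsmul hpp
        ((mem_componentIdeal_compl_singleton hpp).1 (one_sub_componentOne_mem (R := R) {p})) ?_)
      have h0 := addOrderOf_nsmul_eq_zero (1 - componentOne R {p})
      set d := addOrderOf (1 - componentOne R {p})
      rw [nsmul_eq_mul] at h0
      have hdz : d • z = d * (componentOne R {p} * z) := by
        rw [nsmul_eq_mul]
        linear_combination z * h0
      rw [← map_nsmul, hdz, map_mul, (RingHom.mem_ker).1 hzk, mul_zero]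
    obtain ⟨u, hu, hux⟩ := hR.exists_unit_sub_mem hpR (L := RingHom.ker f) (x := x) (e := e)
      (by rw [RingHom.mem_ker, map_mul, map_natCast, he]) (hout x hyp)
      (hout (x + e) (by rwa [map_add]))
    rw [RingHom.sub_mem_ker_iff, map_add] at hux
    have hxI : A.block x ⊆ (I.comap f : Set R)ᶜ := by
      intro z hz hzI
      exact hy (IsASet.subset hI.prop.1 (A.block_mem x) hz hzI (A.mem_block x))
    have huQ : u ∈ componentUnits R Q :=
      componentUnits_mono (Set.singleton_subset_iff.2 (hQ ▸ hp)) hu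
    have hrx : (u : R) * x ∈ A.block x := by
      have h1 : (componentUnits R Q : Set Rˣ) • A.block x = A.block x :=
        hrat _ (A.block_mem x) hxI
      rw [← h1]
      exact Set.smul_mem_smul huQ (A.mem_block x)
    rw [← hux, hB]
    exact ⟨_, hrx, rfl⟩

/-- If `I` and the smallest `A`-ideal containing `R_Q` are disjoint, the sums of basic sets contained
in these ideals are basic. -/
theorem IsTorsionSaturated.add_mem_basicSets {I : Ideal R} {Q : Set ℕ}
    (h : A.IsTorsionSaturated I Q) (hstar : componentIdeal R Q ≤ A.star Q)
    (hJ : I ⊓ A.star Q = ⊥) {X Y : Set R} (hX : X ∈ A.basicSets) (hXI : X ⊆ I)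
    (hY : Y ∈ A.basicSets) (hYI : Y ⊆ A.star Q) : X + Y ∈ A.basicSets := by
  have hdisj : ∀ y ∈ I, y ∈ A.star Q → y = 0 := fun y hy hyQ =>
    (Submodule.eq_bot_iff _).1 hJ y ⟨hy, hyQ⟩
  have hI : ∀ p ∈ Q, ∀ f ∈ I, (p : R) * f = 0 → f = 0 := fun p hp f hfI hf =>
    hdisj f hfI (hstar (h.mem_componentIdeal_of_torsion hp hf))
  obtain ⟨p, hp⟩ := h.exists_mem
  obtain ⟨s, hs0, hs⟩ := h.exists_torsion hp
  have hsI : s ∉ I := fun hsI => hs0 (hI p hp s hsI hs)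
  have hsQ := hstar (h.mem_componentIdeal_of_torsion hp hs)
  have hsub : A.block s ⊆ A.star Q := isASet_iff_block.1 (A.isAIdeal_star Q) s hsQ
  obtain ⟨y, hy⟩ := Setoid.nonempty_of_mem_partition A.isPartition hY
  by_cases hy0 : y = 0
  · subst hy0
    rw [← block_eq hY hy, block_zero, Set.add_singleton]
    simpa using hX
  · have hYs : Y = A.block s := by
      obtain ⟨τ, hτ, hd⟩ := h.exists_mem_block_sub_mem hI hsI (g := y)
        (fun hyI => hy0 (hdisj y hyI (hYI hy)))
      have : y = τ := sub_eq_zero.1 (hdisj _ hd (sub_mem (hYI hy) (hsub hτ)))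
      rw [← block_eq hY hy, this, block_eq_of_mem hτ]
    subst hYs
    obtain ⟨x, hx⟩ := Setoid.nonempty_of_mem_partition A.isPartition hX
    have hsum := (isASet_of_mem hX).add (isASet_block (A := A) s)
    have hmem : x + s ∈ X + A.block s := Set.add_mem_add hx (A.mem_block s)
    have hxs : x + s ∉ I := fun hxsI => hsI ((add_mem_cancel_left (hXI hx)).1 hxsI)
    -- The fibre over `s` is an `A`-set containing `x`, hence all of `X`; `add_mem_block` then
    -- replaces `s` by any point of its block.
    have hfib : X ⊆ {y | y ∈ I ∧ s + y ∈ A.block (x + s)} := by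
      refine IsASet.subset (h.isASet_fibre hI hp hs hs0 hxs) hX hx ⟨hXI hx, ?_⟩
      rw [add_comm s x]
      exact A.mem_block _
    have heq : X + A.block s = A.block (x + s) := by
      refine Set.Subset.antisymm ?_ (isASet_iff_block.1 hsum _ hmem)
      rintro _ ⟨z, hz, τ, hτ, rfl⟩
      have := h.add_mem_block hI hp hs hs0 hxs hτ (hXI hz) (hfib hz).2
      rw [add_comm τ z] at this
      exact this
    rw [heq]
    exact A.block_mem _

theorem componentIdeal_le_star (Q : Set ℕ) : componentIdeal R Q ≤ A.star Q :=
  le_sInf fun _ hK => hK.2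

end SchurRing

/-! ### The main theorem -/

open SchurRing in
theorem mainTheorem4 {R : Type*} [CommRing R] [Finite R] (hR : IsCGRing R)
    (A : SchurRing R) (hA : A.IsOverRing)
    (I : Ideal R) (hI : A.IsMaximalAIdeal I)
    (Q : Set ℕ) (hQ : Q = ↑(Nat.card (R ⧸ I)).primeFactors)
    (hrat : ∀ X ∈ A.basicSets, X ⊆ (I : Set R)ᶜ → IsQRational Q X) :
    A.SatisfiesCondition I (I ⊓ A.star Q) ∧
    (I ⊓ A.star Q = ⊥ →
      ∃ e : (I × A.star Q) ≃+ R, (∀ x y, e (x, y) = (x : R) + (y : R)) ∧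
        A = ((A.restrictIdeal I hI.prop.1).tensor
              (A.restrictIdeal (A.star Q) (A.isAIdeal_star Q))).map e) := by
  have h : A.IsTorsionSaturated I Q :=
    IsTorsionSaturated.of_surjective hR hA (f := RingHom.id R) Function.surjective_id
      (fun x => by simp) (by rwa [Ideal.comap_id]) (by rwa [Ideal.comap_id])
      (by rwa [Ideal.comap_id])
  have hstar := componentIdeal_le_star (A := A) Q
  refine ⟨⟨hI.prop.1, IsASet.inter hI.prop.1 (A.isAIdeal_star Q), fun X hX hXI => ?_⟩,
    fun hJ => ?_⟩
  · obtain ⟨K, hK, hmK⟩ := h.exists_translationIdeal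
    have hKI : K ≤ I := h.le_of_translations fun m hm => (hmK m).1 hm
    let f := Ideal.Quotient.mk K
    have hf : Function.Surjective f := Ideal.Quotient.mk_surjective
    have hker : A.IsASubgroup (f : R →+ R ⧸ K).ker := by
      have : (f : R →+ R ⧸ K).ker = K.toAddSubgroup := by
        ext x
        exact Ideal.Quotient.eq_zero_iff_mem
      rw [this]
      exact hK
    let B := A.pushforward (f : R →+ R ⧸ K) hf hker
    have hB : ∀ x, B.block (f x) = f '' A.block x := fun x =>
      block_eq (show f '' A.block x ∈ B.basicSets from ⟨_, A.block_mem x, rfl⟩) ⟨x, A.mem_block x, rfl⟩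
    have hcomap : (I.map f).comap f = I := Ideal.comap_map_mk hKI
    have h1 : B.IsTorsionSaturated (I.map f) Q :=
      IsTorsionSaturated.of_surjective hR hA hf hB (by rwa [hcomap]) (by rwa [hcomap])
        (by rwa [hcomap])
    -- A translation fixing the outer blocks of the quotient lifts to one fixing those of `A`,
    -- because `K` itself fixes them; so it is zero modulo `K`.
    obtain ⟨hC, hdisj⟩ := h1.isAIdeal_componentIdeal (by
      intro m hm
      obtain ⟨m, rfl⟩ := hf m
      refine Ideal.Quotient.eq_zero_iff_mem.2 ((hmK m).2 fun x hx => ?_)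
      have hx' : f x ∉ I.map f := fun hx' => hx (by rwa [← hcomap])
      have h2 := hm _ hx'
      rw [hB, ← map_add] at h2
      obtain ⟨w, hw, hwx⟩ := h2
      have h3 : x + m - w ∈ K := Ideal.Quotient.eq.1 hwx.symm
      have h4 := (hmK _).1 h3 w (h.notMem_of_mem_block hx hw)
      rwa [add_sub_cancel, block_eq_of_mem hw] at h4)
    -- The preimage is an `A`-ideal containing `R_Q`, so minimality of `A.star Q` applies.
    have hle : A.star Q ≤ (componentIdeal (R ⧸ K) Q).comap f := by
      refine sInf_le ⟨isASet_iff_block.2 fun x hx y hy => ?_, fun x hx p hp hd => ?_⟩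
      · have h5 := isASet_iff_block.1 hC (f x) hx
        rw [hB] at h5
        exact h5 ⟨y, hy, rfl⟩
      · exact hx p hp (hd.trans (addOrderOf_map_dvd (f : R →+ R ⧸ K) x))
    have hJK : I ⊓ A.star Q ≤ K := by
      rintro y ⟨hyI, hyS⟩
      exact Ideal.Quotient.eq_zero_iff_mem.1
        ((Submodule.eq_bot_iff _).1 hdisj (f y) ⟨Ideal.mem_map_of_mem f hyI, hle hyS⟩)
    refine le_inf (hJK.trans (le_sSup ?_)) inf_le_left
    refine Set.Subset.antisymm ?_ fun x hx => ⟨x, hx, 0, K.zero_mem, add_zero x⟩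
    rintro _ ⟨x, hx, k, hk, rfl⟩
    have := (hmK k).1 hk x (hXI hx)
    rwa [block_eq hX hx] at this
  · let φ : I × A.star Q →+ R :=
      (I.toAddSubgroup.subtype).coprod ((A.star Q).toAddSubgroup.subtype)
    have hφ : ∀ x y, φ (x, y) = (x : R) + (y : R) := fun _ _ => rfl
    have hbij : Function.Bijective φ := by
      constructor
      · rw [injective_iff_map_eq_zero]
        rintro ⟨x, y⟩ hxy
        rw [hφ] at hxy
        have hx0 : (x : R) = 0 := by
          refine (Submodule.eq_bot_iff _).1 hJ x ⟨x.2, ?_⟩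
          rw [eq_neg_of_add_eq_zero_left hxy]
          exact neg_mem y.2
        have hy0 : (y : R) = 0 := by rwa [hx0, zero_add] at hxy
        exact Prod.ext (Subtype.ext hx0) (Subtype.ext hy0)
      · intro r
        -- The idempotent `1_Q` decomposes `r`: its complement lies in `I`, and `1_Q` lies in
        -- `A.star Q`.
        refine ⟨(⟨(1 - componentOne R Q) * r, I.mul_mem_right r h.componentOne_compl_mem⟩,
          ⟨componentOne R Q * r,
            (A.star Q).mul_mem_right r (hstar (componentOne_mem R Q))⟩), ?_⟩
        rw [hφ]
        ring
    refine ⟨AddEquiv.ofBijective φ hbij, hφ, eq_of_basicSets_subset ?_⟩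
    rintro _ ⟨_, ⟨X, hX, Y, hY, rfl⟩, rfl⟩
    have hXY := h.add_mem_basicSets hstar hJ (X := Subtype.val '' X) (Y := Subtype.val '' Y) hX
      (by rintro _ ⟨x, -, rfl⟩; exact x.2) hY (by rintro _ ⟨y, -, rfl⟩; exact y.2)
    convert hXY using 1
    ext z
    constructor
    · rintro ⟨⟨x, y⟩, ⟨hx, hy⟩, rfl⟩
      exact ⟨x, ⟨x, hx, rfl⟩, y, ⟨y, hy, rfl⟩, rfl⟩
    · rintro ⟨_, ⟨x, hx, rfl⟩, _, ⟨y, hy, rfl⟩, rfl⟩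
      exact ⟨(x, y), ⟨hx, hy⟩, rfl⟩
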